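/- **Theorem 2.** Let $\nu$ be a probability law on $\{0,1,2,\ldots\}$, let $\xi$ have law $\nu$, and let $f(s)=\mathbf{E}s^{\xi}$. Suppose that $\mathbf{E}\xi=1$ and that, for some $\alpha\in(0,1)$, $$f(s)=s+(1-s)^{1+\alpha}L(1-s),\qquad 0\le s\le 1,$$ where $L(z)$ is slowly varying as $z\downarrow 0$. Consider a Galton–Watson process with offspring law $\nu$ that starts from a single ancestor in generation $0$. Let $Z(n)$ be the number of particles in generation $n$, and for $0\le m\le n$ let $Z(m,n)$ be the number of particles in generation $m$ that have at least one descendant in generation $n$ (with $Z(n,n)=Z(n)$). Let $f_0(s)=s$, $f_n(s)=f(f_{n-1}(s))$ be the iterates of $f$. Let $\varphi(n)$ be a deterministic real function such that $\varphi(n)\to\infty$ and $\varphi(n)/n\to 0$ as $n\to\infty$, and put $$\mathcal{H}(n)=\{0<(1-f_{\lfloor\varphi(n)\rfloor}(0))\,Z(n)\le 1\}.$$ There is exactly one probability law $M$ on $[0,\infty)$ with $$\int_{[0,\infty)}e^{-\lambda y}\,dM(y)=1-\frac{1}{(1+\lambda^{-\alpha})^{1/\alpha}},\qquad \lambda>0,$$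 and for every $x\in(0,\infty)$ and every integer $j\ge 1$ $$\lim_{n\to\infty}\mathbf{P}\bigl(Z(\lfloor n-x\varphi(n)\rfloor,n)=j\,\big|\,\mathcal{H}(n)\bigr)=\frac{\alpha\,\Gamma(j+\alpha)}{j!}\,x\,M^{*j}(x^{-1/\alpha}),$$ where $M^{*j}(y)$ is the distribution function of the $j$-fold convolution of $M$ with itself. -/

import Mathlib

open MeasureTheory ProbabilityTheory Filter Topology
open scoped MeasureTheory

namespace GaltonWatson

/-- Probability generating function `f(s) = E s^ξ` of the offspring law `ν`. -/
noncomputable def genFun (ν : Measure ℕ) (s : ℝ) : ℝ := ∫ k, s ^ k ∂ν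

/-- `L` is slowly varying as `z ↓ 0`. -/
def SlowlyVaryingAtZero (L : ℝ → ℝ) : Prop :=
  (∀ᶠ z in 𝓝[>] (0 : ℝ), 0 < L z) ∧
    ∀ c : ℝ, 0 < c → Tendsto (fun z => L (c * z) / L z) (𝓝[>] 0) (𝓝 1)

/-- The offspring law `ν` has mean one, and `f(s) = s + (1 - s)^(1+α) L(1 - s)` on `[0, 1]`
with `L` slowly varying at zero. -/
structure CriticalOffspring (α : ℝ) (L : ℝ → ℝ) (ν : Measure ℕ) : Prop where
  mean_one : ∫ k, (k : ℝ) ∂ν = 1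
  slowlyVarying : SlowlyVaryingAtZero L
  genFun_eq : ∀ s : ℝ, 0 ≤ s → s ≤ 1 → genFun ν s = s + (1 - s) ^ (1 + α) * L (1 - s)

/-- Particles of generation `n` in the family tree with offspring numbers `c`. A particle is
labelled by a word; its children, numbered from `0`, are the words `i :: u` with `i < c u`. -/
def generation (c : List ℕ → ℕ) : ℕ → Finset (List ℕ)
  | 0 => {[]}
  | n + 1 => (generation c n).biUnion fun u => (Finset.range (c u)).image fun i => i :: u

/-- Size `Z(n)` of generation `n`. -/
def popSize (c : List ℕ → ℕ) (n : ℕ) : ℕ := (generation c n).card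

/-- `Z(m, n)`: number of particles of generation `m` that have a descendant in generation `n`.
The descendants of `u` are the words that end in `u`; a particle is a descendant of itself. -/
def reducedSize (c : List ℕ → ℕ) (m n : ℕ) : ℕ :=
  ((generation c m).filter fun u => ∃ v ∈ generation c n, u <:+ v).card

/-- The family `ξ`, indexed by all possible particles, consists of independent random variables
with law `ν`; the family tree with offspring numbers `ξ u` is then a Galton-Watson tree. -/
structure IsOffspringFamily {Ω : Type*} [MeasurableSpace Ω] (P : Measure Ω)
    (ν : Measure ℕ) (ξ : List ℕ → Ω → ℕ) : Prop where
  measurable : ∀ u, Measurable (ξ u)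
  law : ∀ u, P.map (ξ u) = ν
  indep : iIndepFun ξ P

/-- The small-deviation event `0 < (1 - f_k(0)) Z(n) ≤ 1`, where `f_k` is the `k`-th iterate
of the generating function of the offspring law. -/
def smallDev {Ω : Type*} (ν : Measure ℕ) (ξ : List ℕ → Ω → ℕ) (k n : ℕ) : Set Ω :=
  {ω | 0 < (1 - (genFun ν)^[k] 0) * (popSize (fun u => ξ u ω) n : ℝ) ∧
    (1 - (genFun ν)^[k] 0) * (popSize (fun u => ξ u ω) n : ℝ) ≤ 1}

/-- `M` is a probability law on `[0, ∞)` with Laplace transform `1 - (1 + l^(-α))^(-1/α)`. -/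
structure IsSlackLaw (α : ℝ) (M : Measure ℝ) : Prop where
  prob : IsProbabilityMeasure M
  nonneg : M (Set.Iio 0) = 0
  laplace : ∀ l : ℝ, 0 < l →
    ∫ y, Real.exp (-(l * y)) ∂M = 1 - 1 / (1 + l ^ (-α)) ^ (1 / α)

/-- The `j`-fold convolution of `M` with itself. -/
noncomputable def convPow (M : Measure ℝ) : ℕ → Measure ℝ
  | 0 => Measure.dirac 0
  | j + 1 => Measure.conv (convPow M j) M

end GaltonWatson

/-!
In the coordinate `q = 1 - s` the generating function becomes a map `g` that is concave, fixes `0`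
and has the relative decrement `1 - g q / q` regularly varying with index `α`. The survival
probabilities `Q_n` are the orbit of `1` under `g`, so that `Q_k / Q_n → t ^ (-1 / α)` whenever
`k / n → t`, and iterating `g` from `c * Q_m` amounts to a shift of the index by about
`c ^ (-α) * m`.

Let `m = ⌊φ n⌋` and `p = ⌊n - x * φ n⌋`. Branching at generation `p` expresses the joint transform
of `Q_m * Z(n)` and `Z(p, n)` through iterates of `g`. Divided by `m * (Q_n - Q_{n+1})`, the Laplace
transform of `Q_m * Z(n)` on survival tends to `c ^ (-α)`, that of the density
`y ^ (α - 1) / Γ(α)`; keeping a factor `t ^ Z(p, n)`, the limit becomes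
`x * ((1 - t * Φ) ^ (-α) - 1)`, whose coefficients in `t` are multiples of `Φ ^ j`, where `Φ` is the
Laplace transform of `M` dilated by `x ^ (1 / α)`. By the continuity theorem the measures
themselves converge. The limits have no atom at `1`, being dominated by the power law, so the masses
of `[0, 1]` converge, and their quotient is the asserted limit.
-/

namespace GaltonWatson

/-! ### Orbits of maps with regularly varying decrement -/

section RegularVariation

variable {α ρ : ℝ} {D L : ℝ → ℝ} {ι : Type*} {l : Filter ι} {u v : ι → ℝ} {s t : ℝ}

/-- `D` is regularly varying with index `ρ` as `z ↓ 0`. -/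
def RegularlyVaryingAtZero (ρ : ℝ) (D : ℝ → ℝ) : Prop :=
  (∀ᶠ z in 𝓝[>] (0 : ℝ), 0 < D z) ∧
    ∀ c : ℝ, 0 < c → Tendsto (fun z => D (c * z) / D z) (𝓝[>] 0) (𝓝 (c ^ ρ))

theorem SlowlyVaryingAtZero.rpow_mul (hL : SlowlyVaryingAtZero L) (ρ : ℝ) :
    RegularlyVaryingAtZero ρ fun z => z ^ ρ * L z := by
  refine ⟨?_, fun c hc => ?_⟩
  · filter_upwards [hL.1, self_mem_nhdsWithin] with z hz hz0
    exact mul_pos (Real.rpow_pos_of_pos hz0 ρ) hz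
  · have := (hL.2 c hc).const_mul (c ^ ρ)
    rw [mul_one] at this
    refine this.congr' ?_
    filter_upwards [self_mem_nhdsWithin] with z hz
    have hzρ := (Real.rpow_pos_of_pos (Set.mem_Ioi.1 hz) ρ).ne'
    rw [Real.mul_rpow hc.le (le_of_lt hz), mul_assoc, mul_div_assoc, mul_div_mul_left _ _ hzρ]

theorem tendsto_const_mul_nhdsGT_zero {c : ℝ} (hc : 0 < c) :
    Tendsto (fun q : ℝ => c * q) (𝓝[>] 0) (𝓝[>] 0) := by
  simpa using TendstoNhdsWithinIoi.const_mul hc (tendsto_id (x := 𝓝[>] (0 : ℝ)))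

namespace RegularlyVaryingAtZero

theorem congr {E : ℝ → ℝ} (hD : RegularlyVaryingAtZero ρ D) (hDE : D =ᶠ[𝓝[>] 0] E) :
    RegularlyVaryingAtZero ρ E := by
  refine ⟨?_, fun c hc => (hD.2 c hc).congr' ?_⟩
  · filter_upwards [hD.1, hDE] with z hz hz'
    exact hz' ▸ hz
  · filter_upwards [hDE, (tendsto_const_mul_nhdsGT_zero hc).eventually hDE] with z hz hcz
    rw [hz, hcz]

theorem id_mul (hD : RegularlyVaryingAtZero α D) :
    RegularlyVaryingAtZero (1 + α) fun z => z * D z := by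
  refine ⟨?_, fun c hc => ?_⟩
  · filter_upwards [hD.1, self_mem_nhdsWithin] with z hz hz0
    exact mul_pos hz0 hz
  · rw [Real.rpow_add hc, Real.rpow_one]
    refine ((hD.2 c hc).const_mul c).congr' ?_
    filter_upwards [self_mem_nhdsWithin] with z hz
    rw [mul_assoc, mul_left_comm, mul_div_mul_left _ _ (ne_of_gt hz), mul_div_assoc]

theorem pos (hD : RegularlyVaryingAtZero ρ D) (hmono : MonotoneOn D (Set.Ioc 0 1)) {q : ℝ}
    (hq : q ∈ Set.Ioc (0 : ℝ) 1) : 0 < D q := by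
  obtain ⟨p, hp, hpq⟩ := (hD.1.and (Ioc_mem_nhdsGT hq.1)).exists
  exact hp.trans_le (hmono ⟨hpq.1, hpq.2.trans hq.2⟩ hq hpq.2)

theorem tendsto_zero (hD : RegularlyVaryingAtZero α D) (hα : 0 < α)
    (hmono : MonotoneOn D (Set.Ioc 0 1)) : Tendsto D (𝓝[>] 0) (𝓝 0) := by
  obtain ⟨b, hb⟩ : ∃ b, Tendsto D (𝓝[>] 0) (𝓝 b) :=
    ⟨_, (hmono.mono Set.Ioo_subset_Ioc_self).tendsto_nhdsWithin_Ioo_right (by simp)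
      ⟨0, by rintro _ ⟨q, hq, rfl⟩; exact (hD.pos hmono ⟨hq.1, hq.2.le⟩).le⟩⟩
  have htwo : 2 ^ α * b = b := by
    refine tendsto_nhds_unique (((hD.2 2 two_pos).mul hb).congr' ?_)
      (hb.comp (tendsto_const_mul_nhdsGT_zero two_pos))
    filter_upwards [hD.1] with z hz using div_mul_cancel₀ _ hz.ne'
  have hb0 : b = 0 := by
    have := Real.one_lt_rpow one_lt_two hα
    exact (mul_eq_zero.1 (by linarith : (2 ^ α - 1) * b = 0)).resolve_left (by linarith)
  rwa [hb0] at hb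

end RegularlyVaryingAtZero

theorem tendsto_nhdsGT_zero_of_div (ht : 0 < t) (hv : Tendsto v l (𝓝[>] 0))
    (huv : Tendsto (fun i => u i / v i) l (𝓝 t)) : Tendsto u l (𝓝[>] 0) := by
  rw [tendsto_nhdsWithin_iff] at hv ⊢
  have hu : (fun i => u i / v i * v i) =ᶠ[l] u :=
    hv.2.mono fun i hi => div_mul_cancel₀ _ (ne_of_gt hi)
  refine ⟨by simpa using (huv.mul hv.1).congr' hu, ?_⟩
  filter_upwards [hu, hv.2, huv.eventually (lt_mem_nhds ht)] with i hi hvi huvi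
  exact hi ▸ mul_pos huvi hvi

namespace RegularlyVaryingAtZero

theorem tendsto_div (hD : RegularlyVaryingAtZero ρ D) (hmono : MonotoneOn D (Set.Ioc 0 1))
    (ht : 0 < t) (hv : Tendsto v l (𝓝[>] 0)) (huv : Tendsto (fun i => u i / v i) l (𝓝 t)) :
    Tendsto (fun i => D (u i) / D (v i)) l (𝓝 (t ^ ρ)) := by
  have hIoc : ∀ᶠ q : ℝ in 𝓝[>] 0, q ∈ Set.Ioc (0 : ℝ) 1 := Ioc_mem_nhdsGT one_pos
  have hu1 := (tendsto_nhdsGT_zero_of_div ht hv huv).eventually hIoc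
  have hcont : ContinuousAt (fun c : ℝ => c ^ ρ) t := Real.continuousAt_rpow_const _ _ (.inl ht.ne')
  refine tendsto_order.2 ⟨fun a ha => ?_, fun a ha => ?_⟩
  · obtain ⟨c, hac, hc0, hct⟩ := ((hcont.eventually (lt_mem_nhds ha)).filter_mono
      (nhdsWithin_le_nhds (s := Set.Iio t)) |>.and (Ioo_mem_nhdsLT ht)).exists
    have hcv := (tendsto_const_mul_nhdsGT_zero hc0).comp hv
    filter_upwards [((hD.2 c hc0).comp hv).eventually (lt_mem_nhds hac), hu1, hv.eventually hIoc,
      hcv.eventually hIoc, huv.eventually (lt_mem_nhds hct)] with i hai hui hvi hcvi hcuv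
    have := hD.pos hmono hvi
    refine hai.trans_le (div_le_div_of_nonneg_right (hmono hcvi hui ?_) this.le)
    exact ((lt_div_iff₀ hvi.1).1 hcuv).le
  · obtain ⟨c, hac, htc⟩ := ((hcont.eventually (gt_mem_nhds ha)).filter_mono
      (nhdsWithin_le_nhds (s := Set.Ioi t)) |>.and self_mem_nhdsWithin).exists
    have hc0 : 0 < c := ht.trans htc
    have hcv := (tendsto_const_mul_nhdsGT_zero hc0).comp hv
    filter_upwards [((hD.2 c hc0).comp hv).eventually (gt_mem_nhds hac), hu1, hv.eventually hIoc,
      hcv.eventually hIoc, huv.eventually (gt_mem_nhds htc)] with i hai hui hvi hcvi hcuv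
    have := hD.pos hmono hvi
    refine (div_le_div_of_nonneg_right (hmono hui hcvi ?_) this.le).trans_lt hai
    exact ((div_lt_iff₀ hvi.1).1 hcuv).le

theorem tendsto_div_of_tendsto_div (hD : RegularlyVaryingAtZero α D) (hα : 0 < α)
    (hmono : MonotoneOn D (Set.Ioc 0 1)) (ht : 0 < t) (hu : Tendsto u l (𝓝[>] 0))
    (hv : Tendsto v l (𝓝[>] 0)) (huv : Tendsto (fun i => D (u i) / D (v i)) l (𝓝 (t ^ α))) :
    Tendsto (fun i => u i / v i) l (𝓝 t) := by
  have hIoc : ∀ᶠ q : ℝ in 𝓝[>] 0, q ∈ Set.Ioc (0 : ℝ) 1 := Ioc_mem_nhdsGT one_pos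
  refine tendsto_order.2 ⟨fun a ha => ?_, fun a ha => ?_⟩
  · obtain ⟨c, hac, hct⟩ := exists_between (max_lt ha ht)
    have hc0 : 0 < c := (le_max_right a 0).trans_lt hac
    have hcv := (tendsto_const_mul_nhdsGT_zero hc0).comp hv
    filter_upwards [((hD.2 c hc0).comp hv).eventually_lt huv (Real.rpow_lt_rpow hc0.le hct hα),
      hu.eventually hIoc, hv.eventually hIoc, hcv.eventually hIoc] with i hi hui hvi hcvi
    rw [lt_div_iff₀ hvi.1]
    refine (mul_le_mul_of_nonneg_right ((le_max_left a 0).trans hac.le) hvi.1.le).trans_lt ?_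
    by_contra! hle
    exact (div_le_div_of_nonneg_right (hmono hui hcvi hle) (hD.pos hmono hvi).le).not_gt hi
  · obtain ⟨c, htc, hca⟩ := exists_between ha
    have hc0 : 0 < c := ht.trans htc
    have hcv := (tendsto_const_mul_nhdsGT_zero hc0).comp hv
    filter_upwards [huv.eventually_lt ((hD.2 c hc0).comp hv) (Real.rpow_lt_rpow ht.le htc hα),
      hu.eventually hIoc, hv.eventually hIoc, hcv.eventually hIoc] with i hi hui hvi hcvi
    refine lt_of_lt_of_le ?_ hca.le
    rw [div_lt_iff₀ hvi.1]
    by_contra! hle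
    exact (div_le_div_of_nonneg_right (hmono hcvi hui hle) (hD.pos hmono hvi).le).not_gt hi

end RegularlyVaryingAtZero

end RegularVariation

/-- The relative decrement `1 - g q / q` of a map `g` at `q`; it measures how slowly the orbits of
a map tangent to the identity at zero approach zero. -/
noncomputable def relDecr (g : ℝ → ℝ) (q : ℝ) : ℝ := 1 - g q / q

theorem monotoneOn_relDecr_of_concaveOn {g : ℝ → ℝ} (hg : ConcaveOn ℝ (Set.Icc 0 1) g)
    (hg0 : g 0 = 0) : MonotoneOn (relDecr g) (Set.Ioc 0 1) := by
  have hslope : AntitoneOn (fun q => g q / q) (Set.Ioc 0 1) := by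
    refine ((hg.slope_anti (by simp : (0 : ℝ) ∈ Set.Icc 0 1)).mono fun q hq =>
      ⟨Set.Ioc_subset_Icc_self hq, hq.1.ne'⟩).congr fun q _ => ?_
    rw [slope_def_field, hg0, sub_zero, sub_zero]
  exact fun q hq r hr hqr => sub_le_sub_left (hslope hq hr hqr) 1

/-- A concave map below the identity on `[0, 1]`, fixing zero and tangent to the identity there,
with relative decrement regularly varying of index `α`. The survival probabilities of a critical
Galton-Watson process form the orbit of `1` under such a map. -/
structure IsCriticalStep (α : ℝ) (g : ℝ → ℝ) : Prop where
  map_zero : g 0 = 0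
  pos : ∀ q ∈ Set.Ioc (0 : ℝ) 1, 0 < g q
  lt : ∀ q ∈ Set.Ioc (0 : ℝ) 1, g q < q
  monotoneOn : MonotoneOn g (Set.Icc 0 1)
  concaveOn : ConcaveOn ℝ (Set.Icc 0 1) g
  regularlyVarying : RegularlyVaryingAtZero α (relDecr g)

theorem eq_mul_one_sub_relDecr (g : ℝ → ℝ) {q : ℝ} (hq : q ≠ 0) :
    g q = q * (1 - relDecr g q) := by
  rw [relDecr]
  field_simp
  ring

/-- Secant slopes of a convex function over `[cq, q]` bound its slope over the shorter interval
`[gq, q]`; letting `c → 1` gives a discrete form of the monotone density theorem. -/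
theorem tendsto_slope_mul_div {ρ : ℝ} {h g : ℝ → ℝ} (hconv : ConvexOn ℝ (Set.Icc 0 1) h)
    (hh : RegularlyVaryingAtZero ρ h) (hg : ∀ᶠ q in 𝓝[>] 0, g q < q)
    (hgq : Tendsto (fun q => g q / q) (𝓝[>] 0) (𝓝 1)) :
    Tendsto (fun q => slope h q (g q) * (q / h q)) (𝓝[>] 0) (𝓝 ρ) := by
  have hsecant : Tendsto (fun c : ℝ => (c ^ ρ - 1) / (c - 1)) (𝓝[≠] 1) (𝓝 ρ) := by
    have := (Real.hasDerivAt_rpow_const (p := ρ) (.inl (one_ne_zero' ℝ))).tendsto_slope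
    simpa [slope_fun_def_field] using this
  have hlim : ∀ c : ℝ, 0 < c → Tendsto (fun q => slope h q (c * q) * (q / h q)) (𝓝[>] 0)
      (𝓝 ((c ^ ρ - 1) / (c - 1))) := fun c hc => by
    refine (((hh.2 c hc).sub_const 1).div_const (c - 1)).congr' ?_
    filter_upwards [hh.1, self_mem_nhdsWithin] with q hq hq0
    have := (Set.mem_Ioi.1 hq0).ne'
    rw [slope_def_field, ← sub_one_mul, div_sub_one hq.ne']
    field_simp
  have hg1 : ∀ a < 1, ∀ᶠ q in 𝓝[>] 0, a * q < g q := fun a ha => by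
    filter_upwards [hgq.eventually (lt_mem_nhds ha), self_mem_nhdsWithin] with q hq hq0
    exact (lt_div_iff₀ hq0).1 hq
  have hslope : ∀ᶠ q in 𝓝[>] 0, MonotoneOn (slope h q) (Set.Icc 0 1 \ {q}) :=
    Filter.mem_of_superset (Ioc_mem_nhdsGT one_pos) fun q hq =>
      hconv.slope_mono (Set.Ioc_subset_Icc_self hq)
  refine tendsto_order.2 ⟨fun a ha => ?_, fun a ha => ?_⟩
  · obtain ⟨c, hac, hc0, hc1⟩ := ((hsecant.eventually (lt_mem_nhds ha)).filter_mono
      (nhdsLT_le_nhdsNE 1) |>.and (Ioo_mem_nhdsLT one_pos)).exists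
    filter_upwards [(hlim c hc0).eventually (lt_mem_nhds hac), hg1 c hc1, hg, hslope, hh.1,
      Ioc_mem_nhdsGT one_pos] with q hcq hgc hgq hslope hhq hq
    have hcq0 := mul_pos hc0 hq.1
    refine hcq.trans_le (mul_le_mul_of_nonneg_right (hslope ?_ ?_ hgc.le) (div_pos hq.1 hhq).le)
    · exact ⟨⟨hcq0.le, (hgc.trans hgq).le.trans hq.2⟩, (hgc.trans hgq).ne⟩
    · exact ⟨⟨(hcq0.trans hgc).le, hgq.le.trans hq.2⟩, hgq.ne⟩
  · obtain ⟨c, hac, hc1⟩ := ((hsecant.eventually (gt_mem_nhds ha)).filter_mono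
      (nhdsGT_le_nhdsNE 1) |>.and self_mem_nhdsWithin).exists
    have hc0 : 0 < c := one_pos.trans hc1
    filter_upwards [(hlim c hc0).eventually (gt_mem_nhds hac), hg1 0 one_pos, hg, hslope, hh.1,
      Ioc_mem_nhdsGT one_pos, (tendsto_const_mul_nhdsGT_zero hc0).eventually
      (Ioc_mem_nhdsGT one_pos)] with q hcq hgc hgq hslope hhq hq hcq1
    have hqc : q < c * q := lt_mul_of_one_lt_left hq.1 hc1
    refine (mul_le_mul_of_nonneg_right (hslope ?_ ?_ ?_) (div_pos hq.1 hhq).le).trans_lt hcq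
    · exact ⟨⟨by simpa using hgc.le, hgq.le.trans hq.2⟩, hgq.ne⟩
    · exact ⟨Set.Ioc_subset_Icc_self hcq1, hqc.ne'⟩
    · exact (hgq.trans hqc).le

/-- The decrement `Q_n - Q_{n+1}` of the orbit `Q_n = g^[n] 1`. -/
noncomputable def incr (g : ℝ → ℝ) (n : ℕ) : ℝ := g^[n] 1 - g^[n + 1] 1

/-- The index `N` for which `g^[N + 1] 1 < q ≤ g^[N] 1`. -/
noncomputable def orbitIndex (g : ℝ → ℝ) (q : ℝ) : ℕ := sInf {n | g^[n + 1] 1 < q}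

theorem relDecr_map {g : ℝ → ℝ} {q : ℝ} (hq : q ≠ 0) (hgq : g q ≠ 0) (hne : g q ≠ q) :
    relDecr g (g q) =
      relDecr g q * (1 - slope (fun r => r - g r) q (g q)) / (1 - relDecr g q) := by
  have := sub_ne_zero.2 hne
  rw [slope_def_field, relDecr, relDecr, sub_sub_cancel]
  field_simp
  ring

section IndexRatios

variable {ι : Type*} {l : Filter ι} {a b m : ι → ℕ} {s t : ℝ}

theorem tendsto_atTop_of_natCast_div (ht : 0 < t) (hb : Tendsto b l atTop)
    (hab : Tendsto (fun i => (a i : ℝ) / b i) l (𝓝 t)) : Tendsto a l atTop :=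
  tendsto_natCast_atTop_iff.1 ((tendsto_natCast_atTop_iff.2 hb).num ht hab)

theorem tendsto_natCast_div_trans (hb : Tendsto b l atTop)
    (hab : Tendsto (fun i => (a i : ℝ) / b i) l (𝓝 s))
    (hbm : Tendsto (fun i => (b i : ℝ) / m i) l (𝓝 t)) :
    Tendsto (fun i => (a i : ℝ) / m i) l (𝓝 (s * t)) := by
  refine (hab.mul hbm).congr' ?_
  filter_upwards [hb.eventually (eventually_gt_atTop 0)] with i hi
  exact div_mul_div_cancel₀ (by exact_mod_cast hi.ne')

theorem tendsto_natCast_add_div (hb : Tendsto b l atTop)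
    (hab : Tendsto (fun i => (a i : ℝ) / b i) l (𝓝 t)) :
    Tendsto (fun i => ((b i + a i : ℕ) : ℝ) / b i) l (𝓝 (1 + t)) := by
  refine (hab.const_add 1).congr' ?_
  filter_upwards [hb.eventually (eventually_gt_atTop 0)] with i hi
  have : (b i : ℝ) ≠ 0 := by exact_mod_cast hi.ne'
  push_cast
  field_simp

theorem tendsto_natCast_add_one_div (hb : Tendsto b l atTop)
    (hab : Tendsto (fun i => (a i : ℝ) / b i) l (𝓝 t)) :
    Tendsto (fun i => ((a i + 1 : ℕ) : ℝ) / b i) l (𝓝 t) := by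
  have hinv := (tendsto_natCast_atTop_iff (R := ℝ).2 hb).inv_tendsto_atTop
  simpa [add_div] using! hab.add hinv

end IndexRatios

namespace IsCriticalStep

variable {α : ℝ} {g : ℝ → ℝ}

section Orbit

theorem mem_Ioc (h : IsCriticalStep α g) {q : ℝ} (hq : q ∈ Set.Ioc (0 : ℝ) 1) :
    g q ∈ Set.Ioc (0 : ℝ) 1 :=
  ⟨h.pos q hq, (h.lt q hq).le.trans hq.2⟩

theorem relDecr_monotoneOn (h : IsCriticalStep α g) : MonotoneOn (relDecr g) (Set.Ioc 0 1) :=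
  monotoneOn_relDecr_of_concaveOn h.concaveOn h.map_zero

theorem relDecr_pos (h : IsCriticalStep α g) {q : ℝ} (hq : q ∈ Set.Ioc (0 : ℝ) 1) :
    0 < relDecr g q :=
  h.regularlyVarying.pos h.relDecr_monotoneOn hq

theorem tendsto_relDecr (h : IsCriticalStep α g) (hα : 0 < α) :
    Tendsto (relDecr g) (𝓝[>] 0) (𝓝 0) :=
  h.regularlyVarying.tendsto_zero hα h.relDecr_monotoneOn

theorem iterate_mem (h : IsCriticalStep α g) (n : ℕ) {q : ℝ} (hq : q ∈ Set.Ioc (0 : ℝ) 1) :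
    g^[n] q ∈ Set.Ioc (0 : ℝ) 1 :=
  (show Set.MapsTo g (Set.Ioc 0 1) (Set.Ioc 0 1) from fun _ => h.mem_Ioc).iterate n hq

theorem orbit_mem (h : IsCriticalStep α g) (n : ℕ) : g^[n] 1 ∈ Set.Ioc (0 : ℝ) 1 :=
  h.iterate_mem n ⟨one_pos, le_rfl⟩

theorem orbit_pos (h : IsCriticalStep α g) (n : ℕ) : 0 < g^[n] 1 := (h.orbit_mem n).1

theorem iterate_monotoneOn (h : IsCriticalStep α g) (n : ℕ) :
    MonotoneOn g^[n] (Set.Ioc 0 1) := by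
  induction n with
  | zero => exact monotoneOn_id
  | succ _ ih =>
    intro q hq r hr hqr
    exact ih (h.mem_Ioc hq) (h.mem_Ioc hr)
      (h.monotoneOn (Set.Ioc_subset_Icc_self hq) (Set.Ioc_subset_Icc_self hr) hqr)

theorem orbit_antitone (h : IsCriticalStep α g) : Antitone fun n => g^[n] 1 :=
  antitone_nat_of_succ_le fun n => by
    rw [Function.iterate_succ_apply']
    exact (h.lt _ (h.orbit_mem n)).le

theorem incr_eq (h : IsCriticalStep α g) (n : ℕ) :
    incr g n = g^[n] 1 * relDecr g (g^[n] 1) := by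
  rw [incr, Function.iterate_succ_apply', eq_mul_one_sub_relDecr g (h.orbit_pos n).ne']
  ring

theorem incr_pos (h : IsCriticalStep α g) (n : ℕ) : 0 < incr g n :=
  h.incr_eq n ▸ mul_pos (h.orbit_pos n) (h.relDecr_pos (h.orbit_mem n))

theorem incr_antitone (h : IsCriticalStep α g) : Antitone (incr g) := fun m n hmn => by
  have hle := h.orbit_antitone hmn
  rw [h.incr_eq, h.incr_eq]
  exact mul_le_mul hle (h.relDecr_monotoneOn (h.orbit_mem n) (h.orbit_mem m) hle)
    (h.relDecr_pos (h.orbit_mem n)).le (h.orbit_pos m).le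

theorem orbit_sub_orbit (g : ℝ → ℝ) (p k : ℕ) :
    g^[p] 1 - g^[p + k] 1 = ∑ i ∈ Finset.range k, incr g (p + i) :=
  (Finset.sum_range_sub' (fun i => g^[p + i] 1) k).symm

theorem orbit_sub_le (h : IsCriticalStep α g) (p k : ℕ) :
    g^[p] 1 - g^[p + k] 1 ≤ k * incr g p := by
  rw [orbit_sub_orbit]
  simpa using Finset.sum_le_card_nsmul (Finset.range k) _ _ fun i _ =>
    h.incr_antitone (Nat.le_add_right p i)

theorem le_orbit_sub (h : IsCriticalStep α g) (p k : ℕ) :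
    k * incr g (p + k) ≤ g^[p] 1 - g^[p + k] 1 := by
  rw [orbit_sub_orbit]
  simpa using Finset.card_nsmul_le_sum (Finset.range k) _ _ fun i hi =>
    h.incr_antitone (Nat.add_le_add_left (Finset.mem_range.1 hi).le p)

theorem tendsto_orbit (h : IsCriticalStep α g) : Tendsto (fun n => g^[n] 1) atTop (𝓝[>] 0) := by
  refine tendsto_nhdsWithin_iff.2 ⟨?_, Eventually.of_forall h.orbit_pos⟩
  have hbdd : BddBelow (Set.range fun n => g^[n] 1) :=
    ⟨0, Set.forall_mem_range.2 fun n => (h.orbit_pos n).le⟩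
  have hlim := tendsto_atTop_ciInf h.orbit_antitone hbdd
  set b := ⨅ n, g^[n] 1
  rcases (le_ciInf fun n => (h.orbit_pos n).le : 0 ≤ b).eq_or_lt with hb | hb
  · exact hb ▸ hlim
  have hb1 : b ∈ Set.Ioc (0 : ℝ) 1 := ⟨hb, ciInf_le hbdd 0⟩
  have hstep : b ≤ b * (1 - relDecr g b) := by
    refine le_of_tendsto_of_tendsto' (hlim.comp (tendsto_add_atTop_nat 1))
      (hlim.mul_const (1 - relDecr g b)) fun n => ?_
    have := h.relDecr_monotoneOn hb1 (h.orbit_mem n) (ciInf_le hbdd n)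
    rw [Function.comp_apply, Function.iterate_succ_apply',
      eq_mul_one_sub_relDecr g (h.orbit_pos n).ne']
    exact mul_le_mul_of_nonneg_left (by linarith) (h.orbit_pos n).le
  nlinarith [h.relDecr_pos hb1]

end Orbit

section Asymptotics

variable {ι : Type*} {l : Filter ι} {t : ℝ}

theorem tendsto_inv_relDecr_sub (h : IsCriticalStep α g) (hα : 0 < α) :
    Tendsto (fun q => (relDecr g (g q))⁻¹ - (relDecr g q)⁻¹) (𝓝[>] 0)
      (𝓝 α) := by
  set D := relDecr g
  have hD0 : Tendsto D (𝓝[>] 0) (𝓝 0) := h.tendsto_relDecr hα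
  have hmem : ∀ᶠ q : ℝ in 𝓝[>] 0, q ∈ Set.Ioc (0 : ℝ) 1 := Ioc_mem_nhdsGT one_pos
  have heq : ∀ {q : ℝ}, q ≠ 0 → q - g q = q * D q := fun {q} hq => by
    rw [eq_mul_one_sub_relDecr g hq]
    ring
  have hconv : ConvexOn ℝ (Set.Icc 0 1) fun q => q - g q :=
    (convexOn_id (convex_Icc 0 1)).sub h.concaveOn
  have hratio : Tendsto (fun q => g q / q) (𝓝[>] 0) (𝓝 1) := by
    simpa [D, relDecr] using hD0.const_sub 1
  have hS := tendsto_slope_mul_div hconv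
    (h.regularlyVarying.id_mul.congr
      (Filter.mem_of_superset self_mem_nhdsWithin fun q hq => (heq (ne_of_gt hq)).symm))
    (Filter.mem_of_superset (Ioc_mem_nhdsGT one_pos) h.lt) hratio
  set S := fun q => slope (fun q => q - g q) q (g q)
  have hSD : Tendsto (fun q => S q / D q) (𝓝[>] 0) (𝓝 (1 + α)) := by
    refine hS.congr' ?_
    filter_upwards [hmem] with q hq
    rw [heq hq.1.ne', div_mul_cancel_left₀ hq.1.ne', div_eq_mul_inv]
  have hS0 : Tendsto S (𝓝[>] 0) (𝓝 0) := by
    have := hSD.mul hD0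
    rw [mul_zero] at this
    refine this.congr' ?_
    filter_upwards [hmem] with q hq using div_mul_cancel₀ _ (h.relDecr_pos hq).ne'
  have hlim := (hSD.sub_const 1).div (hS0.const_sub 1) (by simp)
  rw [sub_zero, div_one, add_sub_cancel_left] at hlim
  refine hlim.congr' ?_
  filter_upwards [hmem, hS0.eventually (gt_mem_nhds one_pos)] with q hq hSq
  have hDq : D q ≠ 0 := (h.relDecr_pos hq).ne'
  have hgD : D (g q) = D q * (1 - S q) / (1 - D q) :=
    relDecr_map hq.1.ne' (h.pos q hq).ne' (h.lt q hq).ne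
  rw [hgD]
  have : 1 - S q ≠ 0 := by linarith
  simp only [Pi.div_apply]
  field_simp
  ring

theorem tendsto_natCast_mul_relDecr_orbit (h : IsCriticalStep α g) (hα : 0 < α) :
    Tendsto (fun n : ℕ => n * relDecr g (g^[n] 1)) atTop (𝓝 (1 / α)) := by
  have hcesaro := ((h.tendsto_inv_relDecr_sub hα).comp h.tendsto_orbit).cesaro
  have hsum : ∀ n : ℕ, ∑ i ∈ Finset.range n,
      ((relDecr g (g (g^[i] 1)))⁻¹ - (relDecr g (g^[i] 1))⁻¹) =
      (relDecr g (g^[n] 1))⁻¹ - (relDecr g 1)⁻¹ := fun n => by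
    simpa only [Function.iterate_succ_apply', Function.iterate_zero_apply] using
      Finset.sum_range_sub (fun i => (relDecr g (g^[i] 1))⁻¹) n
  simp only [Function.comp_def, hsum] at hcesaro
  have hinv := ((tendsto_natCast_atTop_atTop (R := ℝ)).inv_tendsto_atTop).mul_const (relDecr g 1)⁻¹
  have hlim := (hcesaro.add hinv).inv₀ (by simpa using hα.ne')
  rw [zero_mul, add_zero] at hlim
  rw [one_div]
  refine hlim.congr fun n => ?_
  simp only [Pi.inv_apply]
  rw [← mul_add, sub_add_cancel, mul_inv, inv_inv, inv_inv]

theorem tendsto_orbit_div (h : IsCriticalStep α g) (hα : 0 < α) {a b : ι → ℕ} (ht : 0 < t)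
    (hb : Tendsto b l atTop) (hab : Tendsto (fun i => (a i : ℝ) / b i) l (𝓝 t)) :
    Tendsto (fun i => g^[a i] 1 / g^[b i] 1) l (𝓝 (t ^ (-(1 / α)))) := by
  have ha := tendsto_atTop_of_natCast_div ht hb hab
  have hD := h.tendsto_natCast_mul_relDecr_orbit hα
  refine h.regularlyVarying.tendsto_div_of_tendsto_div hα h.relDecr_monotoneOn
    (Real.rpow_pos_of_pos ht _) (h.tendsto_orbit.comp ha) (h.tendsto_orbit.comp hb) ?_
  rw [← Real.rpow_mul ht.le, neg_mul, one_div_mul_cancel hα.ne', Real.rpow_neg_one]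
  have hlim := ((hD.comp ha).div (hD.comp hb) (by positivity)).div hab ht.ne'
  rw [div_self (by positivity), one_div] at hlim
  refine hlim.congr' ?_
  filter_upwards [ha.eventually (eventually_gt_atTop 0), hb.eventually (eventually_gt_atTop 0)]
    with i hai hbi
  have hDa := h.relDecr_pos (h.orbit_mem (a i))
  have hDb := h.relDecr_pos (h.orbit_mem (b i))
  have : (a i : ℝ) ≠ 0 := by exact_mod_cast hai.ne'
  have : (b i : ℝ) ≠ 0 := by exact_mod_cast hbi.ne'
  simp only [Function.comp_apply, Pi.div_apply]
  field_simp

theorem tendsto_incr_div (h : IsCriticalStep α g) (hα : 0 < α) {a b : ι → ℕ}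
    (hb : Tendsto b l atTop) (hab : Tendsto (fun i => (a i : ℝ) / b i) l (𝓝 1)) :
    Tendsto (fun i => incr g (a i) / incr g (b i)) l (𝓝 1) := by
  have horbit := h.tendsto_orbit_div hα one_pos hb hab
  rw [Real.one_rpow] at horbit
  have := horbit.mul (h.regularlyVarying.tendsto_div h.relDecr_monotoneOn one_pos
    (h.tendsto_orbit.comp hb) horbit)
  rw [Real.one_rpow, mul_one] at this
  refine this.congr fun i => ?_
  rw [h.incr_eq, h.incr_eq, mul_div_mul_comm, Function.comp_apply]

theorem orbitIndex_lt (h : IsCriticalStep α g) {q : ℝ} (hq : 0 < q) :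
    g^[orbitIndex g q + 1] 1 < q := by
  have hne : {n | g^[n + 1] 1 < q}.Nonempty :=
    (((tendsto_nhdsWithin_iff.1 h.tendsto_orbit).1.comp (tendsto_add_atTop_nat 1)).eventually
      (gt_mem_nhds hq)).exists
  exact Nat.sInf_mem hne

theorem le_orbitIndex {q : ℝ} (hq : q ≤ 1) : q ≤ g^[orbitIndex g q] 1 := by
  rcases hN : orbitIndex g q with _ | N
  · exact hq
  · exact not_lt.1 fun hlt => Nat.notMem_of_lt_sInf (show N < orbitIndex g q by omega) hlt

theorem tendsto_orbitIndex (h : IsCriticalStep α g) :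
    Tendsto (orbitIndex g) (𝓝[>] 0) atTop := by
  refine tendsto_atTop.2 fun K => ?_
  filter_upwards [Ioc_mem_nhdsGT (h.orbit_pos K)] with q hq
  by_contra! hK
  exact ((h.orbit_antitone hK).trans_lt (h.orbitIndex_lt hq.1)).not_ge hq.2

theorem tendsto_orbitIndex_mul_relDecr (h : IsCriticalStep α g) (hα : 0 < α) :
    Tendsto (fun q => orbitIndex g q * relDecr g q) (𝓝[>] 0) (𝓝 (1 / α)) := by
  have hD := h.tendsto_natCast_mul_relDecr_orbit hα
  have hN := h.tendsto_orbitIndex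
  have hsucc : Tendsto (fun n : ℕ => n * relDecr g (g^[n + 1] 1)) atTop (𝓝 (1 / α)) := by
    have := (hD.comp (tendsto_add_atTop_nat 1)).mul (tendsto_natCast_div_add_atTop (1 : ℝ))
    rw [mul_one] at this
    refine this.congr fun n => ?_
    simp only [Function.comp_apply]
    push_cast
    field_simp
  refine tendsto_of_tendsto_of_tendsto_of_le_of_le' (hsucc.comp hN) (hD.comp hN) ?_ ?_
  · filter_upwards [Ioc_mem_nhdsGT one_pos] with q hq
    exact mul_le_mul_of_nonneg_left (h.relDecr_monotoneOn (h.orbit_mem _) hq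
      (h.orbitIndex_lt hq.1).le) (Nat.cast_nonneg _)
  · filter_upwards [Ioc_mem_nhdsGT one_pos] with q hq
    exact mul_le_mul_of_nonneg_left (h.relDecr_monotoneOn hq (h.orbit_mem _)
      (le_orbitIndex hq.2)) (Nat.cast_nonneg _)

theorem tendsto_orbitIndex_div (h : IsCriticalStep α g) (hα : 0 < α) {q : ι → ℝ} {m : ι → ℕ}
    (ht : 0 < t) (hm : Tendsto m l atTop) (hq : Tendsto (fun i => q i / g^[m i] 1) l (𝓝 t)) :
    Tendsto (fun i => (orbitIndex g (q i) : ℝ) / m i) l (𝓝 (t ^ (-α))) := by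
  have hQ := h.tendsto_orbit.comp hm
  have hq0 : Tendsto q l (𝓝[>] 0) := tendsto_nhdsGT_zero_of_div ht hQ hq
  have hD := h.regularlyVarying.tendsto_div h.relDecr_monotoneOn ht hQ hq
  have hlim := (((h.tendsto_orbitIndex_mul_relDecr hα).comp hq0).div
    ((h.tendsto_natCast_mul_relDecr_orbit hα).comp hm) (by positivity)).div hD
    (Real.rpow_pos_of_pos ht α).ne'
  rw [div_self (by positivity), one_div, ← Real.rpow_neg ht.le] at hlim
  refine hlim.congr' ?_
  filter_upwards [hq0.eventually (Ioc_mem_nhdsGT one_pos)] with i hi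
  have hDq := (h.relDecr_pos hi).ne'
  have hDQ := (h.relDecr_pos (h.orbit_mem (m i))).ne'
  simp only [Function.comp_apply, Pi.div_apply]
  field_simp

theorem iterate_mem_Icc (h : IsCriticalStep α g) (p : ℕ) {q : ℝ} (hq : q ∈ Set.Ioc (0 : ℝ) 1) :
    g^[p] q ∈ Set.Icc (g^[p + (orbitIndex g q + 1)] 1) (g^[p + orbitIndex g q] 1) := by
  rw [Function.iterate_add_apply g p, Function.iterate_add_apply g p]
  exact ⟨h.iterate_monotoneOn p (h.orbit_mem _) hq (h.orbitIndex_lt hq.1).le,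
    h.iterate_monotoneOn p hq (h.orbit_mem _) (le_orbitIndex hq.2)⟩

theorem tendsto_orbit_sub_iterate (h : IsCriticalStep α g) (hα : 0 < α) {q : ι → ℝ}
    {m p : ι → ℕ} (ht : 0 < t) (hm : Tendsto m l atTop) (hp : Tendsto p l atTop)
    (hmp : Tendsto (fun i => (m i : ℝ) / p i) l (𝓝 0))
    (hq : Tendsto (fun i => q i / g^[m i] 1) l (𝓝 t)) :
    Tendsto (fun i => (g^[p i] 1 - g^[p i] (q i)) / (m i * incr g (p i))) l (𝓝 (t ^ (-α))) := by
  have hqmem := (tendsto_nhdsGT_zero_of_div ht (h.tendsto_orbit.comp hm) hq).eventually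
    (Ioc_mem_nhdsGT one_pos)
  have hN := h.tendsto_orbitIndex_div hα ht hm hq
  have hincr : Tendsto (fun i => incr g (p i + orbitIndex g (q i)) / incr g (p i)) l (𝓝 1) :=
    h.tendsto_incr_div hα hp (by
      simpa using tendsto_natCast_add_div hp (tendsto_natCast_div_trans hm hN hmp))
  have hlower := hN.mul hincr
  rw [mul_one] at hlower
  refine tendsto_of_tendsto_of_tendsto_of_le_of_le' hlower (tendsto_natCast_add_one_div hm hN) ?_ ?_
  · filter_upwards [hqmem] with i hi
    rw [div_mul_div_comm]
    exact div_le_div_of_nonneg_right ((h.le_orbit_sub _ _).trans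
      (sub_le_sub_left (h.iterate_mem_Icc _ hi).2 _))
      (mul_nonneg (Nat.cast_nonneg _) (h.incr_pos _).le)
  · filter_upwards [hqmem] with i hi
    rw [← mul_div_mul_right ((orbitIndex g (q i) + 1 : ℕ) : ℝ) _ (h.incr_pos (p i)).ne']
    exact div_le_div_of_nonneg_right
      ((sub_le_sub_left (h.iterate_mem_Icc _ hi).1 _).trans (h.orbit_sub_le _ _))
      (mul_nonneg (Nat.cast_nonneg _) (h.incr_pos _).le)

theorem tendsto_iterate_sub_iterate (h : IsCriticalStep α g) (hα : 0 < α) {q r : ι → ℝ}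
    {m p : ι → ℕ} {s : ℝ} (hs : 0 < s) (ht : 0 < t) (hm : Tendsto m l atTop)
    (hp : Tendsto p l atTop) (hmp : Tendsto (fun i => (m i : ℝ) / p i) l (𝓝 0))
    (hq : Tendsto (fun i => q i / g^[m i] 1) l (𝓝 s))
    (hr : Tendsto (fun i => r i / g^[m i] 1) l (𝓝 t)) :
    Tendsto (fun i => (g^[p i] (q i) - g^[p i] (r i)) / (m i * incr g (p i))) l
      (𝓝 (t ^ (-α) - s ^ (-α))) := by
  refine ((h.tendsto_orbit_sub_iterate hα ht hm hp hmp hr).sub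
    (h.tendsto_orbit_sub_iterate hα hs hm hp hmp hq)).congr fun i => ?_
  rw [← sub_div, sub_sub_sub_cancel_left]

theorem tendsto_iterate_div_orbit (h : IsCriticalStep α g) (hα : 0 < α) {q : ι → ℝ}
    {m k : ι → ℕ} {x : ℝ} (ht : 0 < t) (hx : 0 < x) (hm : Tendsto m l atTop)
    (hkm : Tendsto (fun i => (k i : ℝ) / m i) l (𝓝 x))
    (hq : Tendsto (fun i => q i / g^[m i] 1) l (𝓝 t)) :
    Tendsto (fun i => g^[k i] (q i) / g^[k i] 1) l (𝓝 ((1 + t ^ (-α) / x) ^ (-(1 / α)))) := by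
  have hqmem := (tendsto_nhdsGT_zero_of_div ht (h.tendsto_orbit.comp hm) hq).eventually
    (Ioc_mem_nhdsGT one_pos)
  have hk := tendsto_atTop_of_natCast_div hx hm hkm
  have hN : Tendsto (fun i => (orbitIndex g (q i) : ℝ) / k i) l (𝓝 (t ^ (-α) / x)) := by
    rw [div_eq_mul_inv]
    exact tendsto_natCast_div_trans hm (h.tendsto_orbitIndex_div hα ht hm hq)
      (by simpa using hkm.inv₀ hx.ne')
  have hpos : 0 < 1 + t ^ (-α) / x := by positivity
  refine tendsto_of_tendsto_of_tendsto_of_le_of_le'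
    (h.tendsto_orbit_div hα hpos hk
      (tendsto_natCast_add_div hk (tendsto_natCast_add_one_div hk hN)))
    (h.tendsto_orbit_div hα hpos hk (tendsto_natCast_add_div hk hN)) ?_ ?_
  · filter_upwards [hqmem] with i hi
    exact div_le_div_of_nonneg_right (h.iterate_mem_Icc _ hi).1 (h.orbit_pos _).le
  · filter_upwards [hqmem] with i hi
    exact div_le_div_of_nonneg_right (h.iterate_mem_Icc _ hi).2 (h.orbit_pos _).le

end Asymptotics

end IsCriticalStep

theorem tendsto_one_sub_exp_div {ι : Type*} {l : Filter ι} {Q : ι → ℝ}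
    (hQ : Tendsto Q l (𝓝[>] 0)) (c : ℝ) :
    Tendsto (fun i => (1 - Real.exp (-(c * Q i))) / Q i) l (𝓝 c) := by
  have hderiv : HasDerivAt (fun y : ℝ => 1 - Real.exp (-(c * y))) c 0 := by
    simpa using ((hasDerivAt_id (0 : ℝ)).const_mul c).fun_neg.exp.const_sub 1
  refine ((hasDerivAt_iff_tendsto_slope.1 hderiv).comp
    (hQ.mono_right (nhdsGT_le_nhdsNE 0))).congr fun i => ?_
  simp [slope_def_field]

/-- Index sequences of the reduced process: `m n → ∞` is of smaller order than `n`, and the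
generation `p n` lies `k n ~ x * m n` generations before generation `n`. -/
structure IndexScaling (x : ℝ) (m p k : ℕ → ℕ) : Prop where
  tendsto_m : Tendsto m atTop atTop
  m_div : Tendsto (fun n => (m n : ℝ) / n) atTop (𝓝 0)
  k_div : Tendsto (fun n => (k n : ℝ) / m n) atTop (𝓝 x)
  add_eq : ∀ᶠ n in atTop, p n + k n = n

namespace IndexScaling

variable {x : ℝ} {m p k : ℕ → ℕ}

theorem tendsto_k (h : IndexScaling x m p k) (hx : 0 < x) : Tendsto k atTop atTop :=
  tendsto_atTop_of_natCast_div hx h.tendsto_m h.k_div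

theorem p_div (h : IndexScaling x m p k) : Tendsto (fun n => (p n : ℝ) / n) atTop (𝓝 1) := by
  have hk := (tendsto_natCast_div_trans h.tendsto_m h.k_div h.m_div).const_sub 1
  rw [mul_zero, sub_zero] at hk
  refine hk.congr' ?_
  filter_upwards [h.add_eq, eventually_ne_atTop 0] with n hn hn0
  rw [one_sub_div (by exact_mod_cast hn0)]
  congr 1
  exact sub_eq_of_eq_add (by exact_mod_cast hn.symm)

theorem tendsto_p (h : IndexScaling x m p k) : Tendsto p atTop atTop :=
  tendsto_atTop_of_natCast_div one_pos tendsto_id h.p_div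

theorem k_div_p (h : IndexScaling x m p k) : Tendsto (fun n => (k n : ℝ) / p n) atTop (𝓝 0) := by
  have hk := (tendsto_natCast_div_trans h.tendsto_m h.k_div h.m_div).div h.p_div one_ne_zero
  rw [mul_zero, zero_div] at hk
  refine hk.congr' ?_
  filter_upwards [eventually_ne_atTop 0] with n hn0
  exact div_div_div_cancel_right₀ (by exact_mod_cast hn0) _ _

end IndexScaling

namespace IsCriticalStep

variable {α c x : ℝ} {g : ℝ → ℝ} {m p k : ℕ → ℕ}

theorem tendsto_orbit_sub_iterate_one_sub_exp (h : IsCriticalStep α g) (hα : 0 < α)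
    (hm : Tendsto m atTop atTop) (hmn : Tendsto (fun n => (m n : ℝ) / n) atTop (𝓝 0))
    (hc : 0 < c) :
    Tendsto (fun n => (g^[n] 1 - g^[n] (1 - Real.exp (-(c * g^[m n] 1)))) / (m n * incr g n))
      atTop (𝓝 (c ^ (-α))) :=
  h.tendsto_orbit_sub_iterate hα hc hm tendsto_id hmn
    (tendsto_one_sub_exp_div (h.tendsto_orbit.comp hm) c)

theorem tendsto_iterate_one_sub_exp_div_orbit (h : IsCriticalStep α g) (hα : 0 < α) (hx : 0 < x)
    (hm : Tendsto m atTop atTop) (hkm : Tendsto (fun n => (k n : ℝ) / m n) atTop (𝓝 x))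
    (hc : 0 < c) :
    Tendsto (fun n => g^[k n] (1 - Real.exp (-(c * g^[m n] 1))) / g^[k n] 1) atTop
      (𝓝 ((1 + c ^ (-α) / x) ^ (-(1 / α)))) :=
  h.tendsto_iterate_div_orbit hα hc hx hm hkm
    (tendsto_one_sub_exp_div (h.tendsto_orbit.comp hm) c)

theorem tendsto_iterate_orbit_sub_iterate (h : IsCriticalStep α g) (hα : 0 < α) (hx : 0 < x)
    (hs : IndexScaling x m p k) (hc : 0 < c) {t : ℝ} (ht : t ∈ Set.Ico (0 : ℝ) 1) :
    Tendsto (fun n => (g^[p n] (g^[k n] 1) - g^[p n] (g^[k n] 1 -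
        t * (g^[k n] 1 - g^[k n] (1 - Real.exp (-(c * g^[m n] 1)))))) / (m n * incr g n)) atTop
      (𝓝 (x * ((1 - t * (1 - (1 + c ^ (-α) / x) ^ (-(1 / α)))) ^ (-α) - 1))) := by
  have hk := hs.tendsto_k hx
  have hratio := h.tendsto_iterate_one_sub_exp_div_orbit hα hx hs.tendsto_m hs.k_div hc
  set A := (1 + c ^ (-α) / x) ^ (-(1 / α))
  have hA : 0 < A := by positivity
  have hlow : Tendsto (fun n => (g^[k n] 1 - t * (g^[k n] 1 -
      g^[k n] (1 - Real.exp (-(c * g^[m n] 1))))) / g^[k n] 1) atTop (𝓝 (1 - t * (1 - A))) := by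
    refine (((hratio.const_sub 1).const_mul t).const_sub 1).congr fun n => ?_
    have := (h.orbit_pos (k n)).ne'
    field_simp
  have hself : Tendsto (fun n => g^[k n] 1 / g^[k n] 1) atTop (𝓝 1) :=
    tendsto_const_nhds.congr fun n => (div_self (h.orbit_pos (k n)).ne').symm
  have hlim := h.tendsto_iterate_sub_iterate hα one_pos (by nlinarith [ht.1, ht.2] :
    0 < 1 - t * (1 - A)) hk hs.tendsto_p hs.k_div_p hself hlow
  have hincr := h.tendsto_incr_div hα tendsto_id hs.p_div
  rw [Real.one_rpow] at hlim
  have := (hs.k_div.mul hincr).mul hlim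
  rw [mul_one] at this
  refine this.congr' ?_
  filter_upwards [hk.eventually (eventually_ne_atTop 0)] with n hn
  have hk0 : (k n : ℝ) ≠ 0 := by exact_mod_cast hn
  have hp0 := (h.incr_pos (p n)).ne'
  rw [id]
  field_simp

end IsCriticalStep

/-! ### The continuity theorem for Laplace transforms -/

section LaplaceContinuity

variable {ι : Type*} {l : Filter ι}

theorem tendsto_measureReal_of_null_frontier {X : Type*} [MeasurableSpace X] [TopologicalSpace X]
    [HasOuterApproxClosed X] [OpensMeasurableSpace X] {ρ : ι → FiniteMeasure X}
    {ρ' : FiniteMeasure X} (h : Tendsto ρ l (𝓝 ρ')) {A : Set X}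
    (hA : (ρ' : Measure X) (frontier A) = 0) :
    Tendsto (fun i => (ρ i : Measure X).real A) l (𝓝 ((ρ' : Measure X).real A)) := by
  suffices Tendsto (fun i => ρ i A) l (𝓝 (ρ' A)) from NNReal.tendsto_coe.2 this
  rcases eq_or_ne ρ' 0 with rfl | hρ'
  · exact tendsto_of_tendsto_of_tendsto_of_le_of_le tendsto_const_nhds (by simpa using h.mass)
      (fun i => zero_le) fun i => FiniteMeasure.apply_le_mass _ _
  have : Nonempty X := by
    by_contra hX
    rw [not_nonempty_iff] at hX
    exact hρ' (FiniteMeasure.eq_of_forall_apply_eq _ _ fun s _ => by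
      simp [Set.eq_empty_of_isEmpty s])
  simp only [FiniteMeasure.self_eq_mass_mul_normalize _ A]
  refine h.mass.mul (ProbabilityMeasure.tendsto_measure_of_null_frontier_of_tendsto
    (FiniteMeasure.tendsto_normalize_of_tendsto h hρ') ?_)
  rw [FiniteMeasure.normalize_eq_of_nonzero _ hρ', (FiniteMeasure.null_iff_toMeasure_null _ _).2 hA,
    mul_zero]

/-- A measure on `[0, ∞)`, not necessarily finite, whose Laplace transform is finite on
`[1, ∞)`. -/
structure IsLaplaceMeasure (μ : Measure ℝ) : Prop where
  ae_nonneg : ∀ᵐ y ∂μ, 0 ≤ y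
  integrable_exp_neg : Integrable (fun y => Real.exp (-y)) μ

theorem IsLaplaceMeasure.of_ae_nonneg {μ : Measure ℝ} [IsFiniteMeasure μ]
    (h : ∀ᵐ y ∂μ, 0 ≤ y) : IsLaplaceMeasure μ where
  ae_nonneg := h
  integrable_exp_neg := .of_bound (by fun_prop) 1 <| h.mono fun y hy => by
    simpa [Real.abs_exp] using hy

/-- The map `y ↦ exp (-y)` from `[0, ∞)` to `[0, 1]`, constantly `1` on the negative half-line.
It turns Laplace transforms at integers into moments. -/
noncomputable def expNeg (y : ℝ) : unitInterval := Set.projIcc 0 1 zero_le_one (Real.exp (-y))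

theorem coe_expNeg {y : ℝ} (hy : 0 ≤ y) : (expNeg y : ℝ) = Real.exp (-y) :=
  congrArg Subtype.val
    (Set.projIcc_of_mem _ ⟨(Real.exp_pos _).le, Real.exp_le_one_iff.2 (neg_nonpos.2 hy)⟩)

theorem continuous_expNeg : Continuous expNeg :=
  continuous_projIcc.comp (Real.continuous_exp.comp continuous_neg)

theorem expNeg_le_expNeg_iff {Y y : ℝ} (hY : 0 ≤ Y) : expNeg Y ≤ expNeg y ↔ y ≤ Y := by
  refine ⟨fun h => le_of_not_gt fun hYy => h.not_gt ?_, fun h =>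
    Set.monotone_projIcc _ (Real.exp_le_exp.2 (neg_le_neg h))⟩
  rwa [← Subtype.coe_lt_coe, coe_expNeg hY, coe_expNeg (hY.trans hYy.le), Real.exp_lt_exp,
    neg_lt_neg_iff]

namespace IsLaplaceMeasure

variable {μ μ' : Measure ℝ}

theorem integrable_mul_exp_neg (h : IsLaplaceMeasure μ) {F : unitInterval → ℝ}
    (hF : Continuous F) : Integrable (fun y => F (expNeg y) * Real.exp (-y)) μ := by
  obtain ⟨C, hC⟩ := isCompact_univ.exists_bound_of_continuousOn hF.continuousOn
  exact h.integrable_exp_neg.bdd_mul (hF.comp continuous_expNeg).aestronglyMeasurable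
    (Eventually.of_forall fun y => hC _ trivial)

theorem integral_pow_mul_exp_neg (h : IsLaplaceMeasure μ) (k : ℕ) :
    ∫ y, (expNeg y : ℝ) ^ k * Real.exp (-y) ∂μ = ∫ y, Real.exp (-((k + 1 : ℕ) * y)) ∂μ := by
  refine integral_congr_ae (h.ae_nonneg.mono fun y hy => ?_)
  simp only [coe_expNeg hy, ← Real.exp_nat_mul, ← Real.exp_add]
  push_cast
  ring_nf

theorem integral_polynomial_mul_exp_neg (h : IsLaplaceMeasure μ) (p : Polynomial ℝ) :
    ∫ y, p.eval (expNeg y : ℝ) * Real.exp (-y) ∂μ =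
      ∑ k ∈ Finset.range (p.natDegree + 1),
        p.coeff k * ∫ y, Real.exp (-((k + 1 : ℕ) * y)) ∂μ := by
  simp only [Polynomial.eval_eq_sum_range, Finset.sum_mul, mul_assoc]
  rw [integral_finsetSum _ fun k _ => (h.integrable_mul_exp_neg
    (F := fun t => (t : ℝ) ^ k) (by fun_prop)).const_mul _]
  simp only [integral_const_mul, h.integral_pow_mul_exp_neg]

theorem abs_integral_sub_polynomial_le (h : IsLaplaceMeasure μ) {F : unitInterval → ℝ}
    (hF : Continuous F) {p : Polynomial ℝ} {ε : ℝ}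
    (hp : ∀ t : unitInterval, |F t - p.eval (t : ℝ)| ≤ ε) :
    |∫ y, F (expNeg y) * Real.exp (-y) ∂μ - ∫ y, p.eval (expNeg y : ℝ) * Real.exp (-y) ∂μ| ≤
      ε * ∫ y, Real.exp (-y) ∂μ := by
  rw [← integral_sub (h.integrable_mul_exp_neg hF)
    (h.integrable_mul_exp_neg (F := fun t => p.eval (t : ℝ)) (by fun_prop)), ← integral_const_mul]
  refine norm_integral_le_of_norm_le (G := ℝ) (h.integrable_exp_neg.const_mul ε)
    (Eventually.of_forall fun y => ?_)
  rw [← sub_mul, norm_mul, Real.norm_eq_abs, Real.norm_of_nonneg (Real.exp_pos _).le]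
  exact mul_le_mul_of_nonneg_right (hp _) (Real.exp_pos _).le

end IsLaplaceMeasure

section Convergence

variable {μ : ι → Measure ℝ} {μ' : Measure ℝ}

theorem tendsto_integral_mul_exp_neg (hμ : ∀ i, IsLaplaceMeasure (μ i)) (hμ' : IsLaplaceMeasure μ')
    (h : ∀ k : ℕ, Tendsto (fun i => ∫ y, Real.exp (-((k + 1 : ℕ) * y)) ∂μ i) l
      (𝓝 (∫ y, Real.exp (-((k + 1 : ℕ) * y)) ∂μ'))) {F : unitInterval → ℝ} (hF : Continuous F) :
    Tendsto (fun i => ∫ y, F (expNeg y) * Real.exp (-y) ∂μ i) l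
      (𝓝 (∫ y, F (expNeg y) * Real.exp (-y) ∂μ')) := by
  have hmass : Tendsto (fun i => ∫ y, Real.exp (-y) ∂μ i) l (𝓝 (∫ y, Real.exp (-y) ∂μ')) := by
    simpa using h 0
  rw [Metric.tendsto_nhds]
  intro ε hε
  set K := ∫ y, Real.exp (-y) ∂μ'
  have hK₀ : 0 ≤ K := integral_nonneg fun y => (Real.exp_pos _).le
  set δ := ε / (3 * (K + 1)) with hδ
  have hδ₀ : 0 < δ := by positivity
  obtain ⟨p, hp⟩ := exists_polynomial_near_of_continuousOn 0 1 (Set.IccExtend zero_le_one F)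
    (hF.Icc_extend').continuousOn δ hδ₀
  have hp' : ∀ t : unitInterval, |F t - p.eval (t : ℝ)| ≤ δ := fun t => by
    simpa [abs_sub_comm] using (hp t t.2).le
  have hpoly : Tendsto (fun i => ∫ y, p.eval (expNeg y : ℝ) * Real.exp (-y) ∂μ i) l
      (𝓝 (∫ y, p.eval (expNeg y : ℝ) * Real.exp (-y) ∂μ')) := by
    simp only [(hμ _).integral_polynomial_mul_exp_neg, hμ'.integral_polynomial_mul_exp_neg]
    exact tendsto_finsetSum _ fun k _ => (h k).const_mul _
  have hδK : δ * (K + 1) = ε / 3 := by rw [hδ]; field_simp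
  filter_upwards [hmass.eventually_lt_const (lt_add_one K),
    (Metric.tendsto_nhds.1 hpoly) (ε / 3) (by positivity)] with i hmi hpi
  have h1 := abs_le.1 ((hμ i).abs_integral_sub_polynomial_le hF hp')
  have h2 := abs_le.1 (hμ'.abs_integral_sub_polynomial_le hF hp')
  have h3 : δ * ∫ y, Real.exp (-y) ∂μ i ≤ ε / 3 := hδK ▸ by gcongr
  have h4 : δ * K < ε / 3 := hδK ▸ by gcongr; exact lt_add_one K
  rw [Real.dist_eq, abs_lt] at hpi ⊢
  constructor <;> linarith [h1.1, h1.2, h2.1, h2.2, hpi.1, hpi.2]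

end Convergence

/-- The finite measure on `[0, 1]` obtained from `μ` by damping it beyond `Y` with the density
`exp (Y - y)` and pushing it forward under `y ↦ exp (-y)`. -/
noncomputable def expTilt (Y : ℝ) (μ : Measure ℝ) : Measure unitInterval :=
  (μ.withDensity fun y => ENNReal.ofReal (min 1 (Real.exp (Y - y)))).map expNeg

theorem expTilt_apply (μ : Measure ℝ) {Y : ℝ} (hY : 0 ≤ Y) {A : Set unitInterval}
    (hA : MeasurableSet A) (hAY : A ⊆ Set.Ici (expNeg Y)) :
    expTilt Y μ A = μ (expNeg ⁻¹' A) := by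
  have hA' : MeasurableSet (expNeg ⁻¹' A) := continuous_expNeg.measurable hA
  rw [expTilt, Measure.map_apply continuous_expNeg.measurable hA, withDensity_apply _ hA',
    ← setLIntegral_one]
  refine setLIntegral_congr_fun hA' fun y hy => ?_
  rw [min_eq_left (Real.one_le_exp (sub_nonneg.2 (expNeg_le_expNeg_iff hY |>.1 (hAY hy)))),
    ENNReal.ofReal_one]

theorem expTilt_Ici (μ : Measure ℝ) {Y : ℝ} (hY : 0 ≤ Y) :
    expTilt Y μ (Set.Ici (expNeg Y)) = μ (Set.Iic Y) := by
  rw [expTilt_apply μ hY measurableSet_Ici subset_rfl]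
  exact congrArg μ (Set.ext fun y => expNeg_le_expNeg_iff hY)

namespace IsLaplaceMeasure

variable {μ μ' : Measure ℝ}

theorem integral_expTilt (h : IsLaplaceMeasure μ) (Y : ℝ) {F : unitInterval → ℝ}
    (hF : Continuous F) :
    ∫ t, F t ∂expTilt Y μ =
      ∫ y, F (expNeg y) / max (expNeg y : ℝ) (Real.exp (-Y)) * Real.exp (-y) ∂μ := by
  rw [expTilt, integral_map continuous_expNeg.aemeasurable hF.aestronglyMeasurable,
    integral_withDensity_eq_integral_toReal_smul (by fun_prop)
      (Eventually.of_forall fun _ => ENNReal.ofReal_lt_top)]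
  refine integral_congr_ae (h.ae_nonneg.mono fun y hy => ?_)
  have hmin : min 1 (Real.exp (Y - y)) * max (Real.exp (-y)) (Real.exp (-Y)) = Real.exp (-y) := by
    rcases le_total y Y with hyY | hyY
    · rw [min_eq_left (Real.one_le_exp (by linarith)), one_mul,
        max_eq_left (Real.exp_le_exp.2 (by linarith))]
    · rw [min_eq_right (Real.exp_le_one_iff.2 (by linarith)),
        max_eq_right (Real.exp_le_exp.2 (by linarith)), ← Real.exp_add]
      ring_nf
  have hmax : 0 < max (Real.exp (-y)) (Real.exp (-Y)) := lt_max_of_lt_left (Real.exp_pos _)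
  simp only [coe_expNeg hy, smul_eq_mul]
  rw [ENNReal.toReal_ofReal (by positivity), div_mul_eq_mul_div, eq_div_iff hmax.ne']
  linear_combination F (expNeg y) * hmin

theorem isFiniteMeasure_expTilt (h : IsLaplaceMeasure μ) (Y : ℝ) :
    IsFiniteMeasure (expTilt Y μ) := by
  have hint : Integrable (fun y => min 1 (Real.exp (Y - y))) μ := by
    refine (h.integrable_exp_neg.const_mul (Real.exp Y)).mono' (by fun_prop)
      (Eventually.of_forall fun y => ?_)
    rw [Real.norm_of_nonneg (by positivity), ← Real.exp_add, ← sub_eq_add_neg]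
    exact min_le_right _ _
  have := isFiniteMeasure_withDensity_ofReal hint.2
  exact Measure.isFiniteMeasure_map _ _

theorem expTilt_singleton (h : IsLaplaceMeasure μ) {Y : ℝ} (hY : 0 ≤ Y) :
    expTilt Y μ {expNeg Y} = μ {Y} := by
  rw [expTilt_apply μ hY (measurableSet_singleton _) (by simp)]
  refine measure_congr (h.ae_nonneg.mono fun y hy => propext ?_)
  change expNeg y = expNeg Y ↔ y = Y
  rw [← Subtype.coe_inj, coe_expNeg hy, coe_expNeg hY, Real.exp_eq_exp, neg_inj]

end IsLaplaceMeasure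

/-- The measure `expTilt Y μ` bundled as a finite measure, the form in which weak convergence is
available. -/
noncomputable def IsLaplaceMeasure.tilt {μ : Measure ℝ} (h : IsLaplaceMeasure μ) (Y : ℝ) :
    FiniteMeasure unitInterval :=
  ⟨expTilt Y μ, h.isFiniteMeasure_expTilt Y⟩

section Convergence

variable {μ : ι → Measure ℝ} {μ' : Measure ℝ}

theorem tendsto_tilt (hμ : ∀ i, IsLaplaceMeasure (μ i)) (hμ' : IsLaplaceMeasure μ')
    (h : ∀ k : ℕ, Tendsto (fun i => ∫ y, Real.exp (-((k + 1 : ℕ) * y)) ∂μ i) l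
      (𝓝 (∫ y, Real.exp (-((k + 1 : ℕ) * y)) ∂μ'))) (Y : ℝ) :
    Tendsto (fun i => (hμ i).tilt Y) l (𝓝 (hμ'.tilt Y)) := by
  rw [FiniteMeasure.tendsto_iff_forall_integral_tendsto]
  intro F
  simp only [IsLaplaceMeasure.tilt, FiniteMeasure.toMeasure_mk,
    (hμ _).integral_expTilt Y F.continuous, hμ'.integral_expTilt Y F.continuous]
  refine tendsto_integral_mul_exp_neg hμ hμ' h
    (F := fun t => F t / max (t : ℝ) (Real.exp (-Y))) ?_
  exact F.continuous.div (by fun_prop) fun t => (lt_max_of_lt_right (Real.exp_pos _)).ne'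

theorem tendsto_measureReal_Iic (hμ : ∀ i, IsLaplaceMeasure (μ i)) (hμ' : IsLaplaceMeasure μ')
    (h : ∀ k : ℕ, Tendsto (fun i => ∫ y, Real.exp (-((k + 1 : ℕ) * y)) ∂μ i) l
      (𝓝 (∫ y, Real.exp (-((k + 1 : ℕ) * y)) ∂μ'))) {Y : ℝ} (hY : 0 ≤ Y) (hμY : μ' {Y} = 0) :
    Tendsto (fun i => (μ i).real (Set.Iic Y)) l (𝓝 (μ'.real (Set.Iic Y))) := by
  have hfr : expTilt Y μ' (frontier (Set.Ici (expNeg Y))) = 0 :=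
    measure_mono_null (frontier_Ici_subset _) (hμ'.expTilt_singleton hY ▸ hμY)
  simpa only [IsLaplaceMeasure.tilt, FiniteMeasure.toMeasure_mk, Measure.real,
    expTilt_Ici _ hY]
    using tendsto_measureReal_of_null_frontier (tendsto_tilt hμ hμ' h Y) hfr

end Convergence

theorem IsLaplaceMeasure.ext {μ μ' : Measure ℝ} [IsFiniteMeasure μ] (hμ : IsLaplaceMeasure μ)
    (hμ' : IsLaplaceMeasure μ') (h : ∀ k : ℕ, ∫ y, Real.exp (-((k + 1 : ℕ) * y)) ∂μ =
      ∫ y, Real.exp (-((k + 1 : ℕ) * y)) ∂μ') : μ = μ' := by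
  refine Measure.ext_of_Iic _ _ fun Y => ?_
  rcases le_or_gt 0 Y with hY | hY
  · have hlim := tendsto_tilt (l := (⊤ : Filter Unit)) (fun _ => hμ) hμ'
      (fun k => (h k) ▸ tendsto_const_nhds) Y
    have := congrArg (fun ρ : FiniteMeasure unitInterval =>
      (ρ : Measure unitInterval) (Set.Ici (expNeg Y))) (tendsto_nhds_unique tendsto_const_nhds hlim)
    simpa only [IsLaplaceMeasure.tilt, FiniteMeasure.toMeasure_mk, expTilt_Ici _ hY] using this
  · have hnull : ∀ {σ : Measure ℝ}, IsLaplaceMeasure σ → σ (Set.Iic Y) = 0 := fun hσ =>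
      measure_mono_null (fun y (hy : y ≤ Y) => not_le.2 (hy.trans_lt hY)) (ae_iff.1 hσ.ae_nonneg)
    rw [hnull hμ, hnull hμ']

theorem measure_le_of_tendsto_of_le [l.NeBot] {X : Type*} [MeasurableSpace X] [TopologicalSpace X]
    [HasOuterApproxClosed X] [OpensMeasurableSpace X] {ρ σ : ι → FiniteMeasure X}
    {ρ' σ' : FiniteMeasure X} (hρ : Tendsto ρ l (𝓝 ρ')) (hσ : Tendsto σ l (𝓝 σ'))
    (hle : ∀ i, (ρ i : Measure X) ≤ σ i) {F : Set X} (hF : IsClosed F) :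
    (ρ' : Measure X) F ≤ (σ' : Measure X) F := by
  rw [FiniteMeasure.tendsto_iff_forall_lintegral_tendsto] at hρ hσ
  exact le_of_tendsto_of_tendsto' (HasOuterApproxClosed.tendsto_lintegral_apprSeq hF _)
    (HasOuterApproxClosed.tendsto_lintegral_apprSeq hF _)
    fun k => le_of_tendsto_of_tendsto' (hρ _) (hσ _) fun i => lintegral_mono' (hle i) le_rfl

theorem expTilt_mono {μ σ : Measure ℝ} (h : μ ≤ σ) (Y : ℝ) : expTilt Y μ ≤ expTilt Y σ := by
  refine Measure.map_mono (Measure.le_intro fun A hA _ => ?_) continuous_expNeg.measurable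
  rw [withDensity_apply _ hA, withDensity_apply _ hA]
  exact lintegral_mono' (Measure.restrict_mono le_rfl h) le_rfl

section Convergence

variable {μ σ : ι → Measure ℝ} {μ' σ' : Measure ℝ}

theorem measure_singleton_le_of_le [l.NeBot] (hμ : ∀ i, IsLaplaceMeasure (μ i))
    (hμ' : IsLaplaceMeasure μ') (hσ : ∀ i, IsLaplaceMeasure (σ i)) (hσ' : IsLaplaceMeasure σ')
    (hle : ∀ i, μ i ≤ σ i)
    (hlimμ : ∀ k : ℕ, Tendsto (fun i => ∫ y, Real.exp (-((k + 1 : ℕ) * y)) ∂μ i) l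
      (𝓝 (∫ y, Real.exp (-((k + 1 : ℕ) * y)) ∂μ')))
    (hlimσ : ∀ k : ℕ, Tendsto (fun i => ∫ y, Real.exp (-((k + 1 : ℕ) * y)) ∂σ i) l
      (𝓝 (∫ y, Real.exp (-((k + 1 : ℕ) * y)) ∂σ'))) {Y : ℝ} (hY : 0 ≤ Y) :
    μ' {Y} ≤ σ' {Y} := by
  rw [← hμ'.expTilt_singleton hY, ← hσ'.expTilt_singleton hY]
  exact measure_le_of_tendsto_of_le (tendsto_tilt hμ hμ' hlimμ Y) (tendsto_tilt hσ hσ' hlimσ Y)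
    (fun i => expTilt_mono (hle i) Y) isClosed_singleton

theorem tendsto_measureReal_Iic_of_le [l.NeBot] (hμ : ∀ i, IsLaplaceMeasure (μ i))
    (hμ' : IsLaplaceMeasure μ') (hσ : ∀ i, IsLaplaceMeasure (σ i)) (hσ' : IsLaplaceMeasure σ')
    (hle : ∀ i, μ i ≤ σ i)
    (hlimμ : ∀ k : ℕ, Tendsto (fun i => ∫ y, Real.exp (-((k + 1 : ℕ) * y)) ∂μ i) l
      (𝓝 (∫ y, Real.exp (-((k + 1 : ℕ) * y)) ∂μ')))
    (hlimσ : ∀ k : ℕ, Tendsto (fun i => ∫ y, Real.exp (-((k + 1 : ℕ) * y)) ∂σ i) l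
      (𝓝 (∫ y, Real.exp (-((k + 1 : ℕ) * y)) ∂σ'))) {Y : ℝ} (hY : 0 ≤ Y) (hσY : σ' {Y} = 0) :
    Tendsto (fun i => (μ i).real (Set.Iic Y)) l (𝓝 (μ'.real (Set.Iic Y))) :=
  tendsto_measureReal_Iic hμ hμ' hlimμ hY <| nonpos_iff_eq_zero.1 <|
    (measure_singleton_le_of_le hμ hμ' hσ hσ' hle hlimμ hlimσ hY).trans_eq hσY

end Convergence

theorem isLaplaceMeasure_map_natCast (ρ : Measure ℕ) [IsFiniteMeasure ρ] :
    IsLaplaceMeasure (ρ.map ((↑) : ℕ → ℝ)) :=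
  .of_ae_nonneg <| (ae_map_iff (by fun_prop) measurableSet_Ici).2 <|
    .of_forall fun j => Nat.cast_nonneg j

section Nat

variable {ρ : ι → Measure ℕ} [∀ i, IsFiniteMeasure (ρ i)] {ρ' : Measure ℕ} [IsFiniteMeasure ρ']

theorem tendsto_measureReal_Iic_nat
    (h : ∀ k : ℕ, Tendsto (fun i => ∫ j : ℕ, Real.exp (-((k + 1 : ℕ) * j)) ∂ρ i) l
      (𝓝 (∫ j : ℕ, Real.exp (-((k + 1 : ℕ) * j)) ∂ρ'))) (n : ℕ) :
    Tendsto (fun i => (ρ i).real (Set.Iic n)) l (𝓝 (ρ'.real (Set.Iic n))) := by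
  have hcast : Measurable ((↑) : ℕ → ℝ) := by fun_prop
  have hpre : ((↑) : ℕ → ℝ) ⁻¹' Set.Iic (n + 1 / 2 : ℝ) = Set.Iic n := by
    ext i
    have : (i : ℝ) ≤ n + 1 / 2 ↔ i ≤ n := by
      rw [← mul_le_mul_iff_right₀ (two_pos (α := ℝ))]
      norm_num [mul_add]
      norm_cast
      omega
    exact this
  have hnull : (ρ'.map ((↑) : ℕ → ℝ)) {(n + 1 / 2 : ℝ)} = 0 := by
    rw [Measure.map_apply hcast (measurableSet_singleton _)]
    convert measure_empty (μ := ρ')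
    ext i
    have : (i : ℝ) ≠ n + 1 / 2 := fun hi => by
      have : 2 * i = 2 * n + 1 := by exact_mod_cast (by linarith : (2 * i : ℝ) = 2 * n + 1)
      omega
    simpa using this
  have := tendsto_measureReal_Iic (fun i => isLaplaceMeasure_map_natCast (ρ i))
    (isLaplaceMeasure_map_natCast ρ') (fun k => by
      have hexp : Continuous fun y : ℝ => Real.exp (-((k + 1 : ℕ) * y)) := by fun_prop
      simpa only [integral_map hcast.aemeasurable hexp.aestronglyMeasurable] using h k)
    (by positivity) hnull
  simpa only [map_measureReal_apply hcast measurableSet_Iic, hpre] using this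

theorem tendsto_measureReal_singleton_nat
    (h : ∀ k : ℕ, Tendsto (fun i => ∫ j : ℕ, Real.exp (-((k + 1 : ℕ) * j)) ∂ρ i) l
      (𝓝 (∫ j : ℕ, Real.exp (-((k + 1 : ℕ) * j)) ∂ρ'))) (j : ℕ) :
    Tendsto (fun i => (ρ i).real {j}) l (𝓝 (ρ'.real {j})) := by
  cases j with
  | zero =>
    have hzero : ({0} : Set ℕ) = Set.Iic 0 := Set.Iic_bot.symm
    exact hzero ▸ tendsto_measureReal_Iic_nat h 0
  | succ j =>
    have hdiff : ∀ σ : Measure ℕ, IsFiniteMeasure σ →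
        σ.real {j + 1} = σ.real (Set.Iic (j + 1)) - σ.real (Set.Iic j) := fun σ _ => by
      rw [← measureReal_sdiff (Set.Iic_subset_Iic.2 j.le_succ) measurableSet_Iic]
      congr 1 with i
      simp only [Set.mem_singleton_iff, Set.mem_sdiff, Set.mem_Iic]
      omega
    rw [hdiff ρ' inferInstance]
    exact ((tendsto_measureReal_Iic_nat h (j + 1)).sub (tendsto_measureReal_Iic_nat h j)).congr
      fun i => (hdiff (ρ i) inferInstance).symm

end Nat

theorem ae_pos_of_tendsto_integral_rpow {ρ : Measure unitInterval} [IsProbabilityMeasure ρ]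
    (h : Tendsto (fun c : ℝ => ∫ t, (t : ℝ) ^ c ∂ρ) (𝓝[>] 0) (𝓝 1)) :
    ∀ᵐ t : unitInterval ∂ρ, 0 < (t : ℝ) := by
  have hlim : Tendsto (fun c : ℝ => ∫ t, (t : ℝ) ^ c ∂ρ) (𝓝[>] 0)
      (𝓝 (∫ t, ({t : unitInterval | 0 < (t : ℝ)}.indicator 1 t : ℝ) ∂ρ)) := by
    refine tendsto_integral_filter_of_dominated_convergence 1 ?_ ?_ (integrable_const 1) ?_
    · filter_upwards [self_mem_nhdsWithin] with c hc
      exact (continuous_subtype_val.rpow_const fun _ => Or.inr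
        (le_of_lt hc)).aestronglyMeasurable
    · filter_upwards [self_mem_nhdsWithin] with c hc
      refine Eventually.of_forall fun t => ?_
      rw [Real.norm_of_nonneg (Real.rpow_nonneg t.2.1 c)]
      exact Real.rpow_le_one t.2.1 t.2.2 (le_of_lt hc)
    · refine Eventually.of_forall fun t => ?_
      rcases t.2.1.eq_or_lt with ht | ht
      · refine tendsto_const_nhds.congr' ?_
        filter_upwards [self_mem_nhdsWithin] with c hc
        rw [← ht, Real.zero_rpow (ne_of_gt hc), Set.indicator_of_notMem]
        exact ht.not_lt
      · have := (Real.continuous_const_rpow ht.ne').tendsto 0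
        rw [Real.rpow_zero] at this
        rw [Set.indicator_of_mem (show t ∈ {t : unitInterval | 0 < (t : ℝ)} from ht)]
        exact this.mono_left nhdsWithin_le_nhds
  have hone := tendsto_nhds_unique hlim h
  have hmeas : MeasurableSet {t : unitInterval | 0 < (t : ℝ)} := by measurability
  rw [integral_indicator_one hmeas] at hone
  exact (mem_ae_iff_prob_eq_one hmeas).2 (by
    rw [← ENNReal.toReal_eq_one_iff]
    exact hone)

theorem exists_tendsto_integral_of_isProbabilityMeasure [l.NeBot]
    {μ : ι → Measure ℝ} [∀ i, IsProbabilityMeasure (μ i)]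
    (hμ : ∀ i, ∀ᵐ y ∂μ i, 0 ≤ y) {ψ : ℝ → ℝ}
    (hlim : ∀ c : ℝ, 0 < c → Tendsto (fun i => ∫ y, Real.exp (-(c * y)) ∂μ i) l (𝓝 (ψ c))) :
    ∃ ρ : Measure unitInterval, IsProbabilityMeasure ρ ∧
      ∀ c : ℝ, 0 < c → ∫ t, (t : ℝ) ^ c ∂ρ = ψ c := by
  let ρ : ι → ProbabilityMeasure unitInterval := fun i =>
    ⟨(μ i).map expNeg, Measure.isProbabilityMeasure_map continuous_expNeg.aemeasurable⟩
  obtain ⟨ρ', -, hρ'⟩ := isCompact_univ.ultrafilter_le_nhds ((Ultrafilter.of l).map ρ) (by simp)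
  refine ⟨ρ', inferInstance, fun c hc => ?_⟩
  have hcont : Continuous fun t : unitInterval => (t : ℝ) ^ c :=
    continuous_subtype_val.rpow_const fun _ => Or.inr hc.le
  refine tendsto_nhds_unique (ProbabilityMeasure.tendsto_iff_forall_integral_tendsto.1
    (show Tendsto ρ (Ultrafilter.of l) (𝓝 ρ') from hρ')
    (BoundedContinuousFunction.mkOfCompact ⟨_, hcont⟩))
    (((hlim c hc).mono_left (Ultrafilter.of_le l)).congr fun i => ?_)
  change _ = ∫ t, (t : ℝ) ^ c ∂(μ i).map expNeg
  rw [integral_map continuous_expNeg.aemeasurable hcont.aestronglyMeasurable]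
  refine integral_congr_ae ((hμ i).mono fun y hy => ?_)
  simp only [coe_expNeg hy, ← Real.exp_mul]
  ring_nf

theorem exists_isProbabilityMeasure_of_tendsto_laplace [l.NeBot] {μ : ι → Measure ℝ}
    [∀ i, IsProbabilityMeasure (μ i)] (hμ : ∀ i, ∀ᵐ y ∂μ i, 0 ≤ y) {ψ : ℝ → ℝ}
    (hlim : ∀ c : ℝ, 0 < c → Tendsto (fun i => ∫ y, Real.exp (-(c * y)) ∂μ i) l (𝓝 (ψ c)))
    (hψ : Tendsto ψ (𝓝[>] 0) (𝓝 1)) :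
    ∃ M : Measure ℝ, IsProbabilityMeasure M ∧ (∀ᵐ y ∂M, 0 ≤ y) ∧
      ∀ c : ℝ, 0 < c → ∫ y, Real.exp (-(c * y)) ∂M = ψ c := by
  obtain ⟨ρ, _, hρ⟩ := exists_tendsto_integral_of_isProbabilityMeasure hμ hlim
  have hpos : ∀ᵐ t : unitInterval ∂ρ, 0 < (t : ℝ) := ae_pos_of_tendsto_integral_rpow
    (hψ.congr' (eventually_nhdsWithin_of_forall fun c hc => (hρ c hc).symm))
  have hlog : Measurable fun t : unitInterval => -Real.log t := by fun_prop
  refine ⟨ρ.map fun t : unitInterval => -Real.log t,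
    Measure.isProbabilityMeasure_map hlog.aemeasurable,
    (ae_map_iff hlog.aemeasurable measurableSet_Ici).2 (Eventually.of_forall fun t =>
      neg_nonneg.2 (Real.log_nonpos t.2.1 t.2.2)), fun c hc => ?_⟩
  have hexp : Continuous fun y : ℝ => Real.exp (-(c * y)) := by fun_prop
  rw [integral_map hlog.aemeasurable hexp.aestronglyMeasurable, ← hρ c hc]
  refine integral_congr_ae (hpos.mono fun t ht => ?_)
  simp only [Real.rpow_def_of_pos ht]
  ring_nf

end LaplaceContinuity

/-! ### Galton–Watson trees -/

/-- The family tree `c` seen from the `i`-th child of its root. -/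
def subtree (c : List ℕ → ℕ) (i : ℕ) : List ℕ → ℕ := fun u => c (u ++ [i])

section Trees

variable {c : List ℕ → ℕ} {m n : ℕ}

theorem mem_generation_succ {w : List ℕ} :
    w ∈ generation c (n + 1) ↔ ∃ u ∈ generation c n, ∃ i < c u, i :: u = w := by
  simp [generation]

theorem mem_generation_succ_iff_subtree {w : List ℕ} :
    w ∈ generation c (n + 1) ↔
      ∃ i < c [], ∃ v ∈ generation (subtree c i) n, v ++ [i] = w := by
  induction n generalizing w with
  | zero => simp [generation]
  | succ n ih =>
    rw [mem_generation_succ]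
    constructor
    · rintro ⟨u, hu, k, hk, rfl⟩
      obtain ⟨i, hi, v, hv, rfl⟩ := ih.1 hu
      exact ⟨i, hi, k :: v, mem_generation_succ.2 ⟨v, hv, k, hk, rfl⟩, rfl⟩
    · rintro ⟨i, hi, _, hkv, rfl⟩
      obtain ⟨v, hv, k, hk, rfl⟩ := mem_generation_succ.1 hkv
      exact ⟨v ++ [i], ih.2 ⟨i, hi, v, hv, rfl⟩, k, hk, rfl⟩

theorem append_singleton_inj {v w : List ℕ} {i j : ℕ} :
    v ++ [i] = w ++ [j] ↔ v = w ∧ i = j := by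
  simp

theorem card_biUnion_image_append (s : Finset ℕ) (A : ℕ → Finset (List ℕ)) :
    (s.biUnion fun i => (A i).image fun v => v ++ [i]).card = ∑ i ∈ s, (A i).card := by
  rw [Finset.card_biUnion]
  · exact Finset.sum_congr rfl fun i _ =>
      Finset.card_image_of_injective _ (List.append_left_injective [i])
  · refine fun i _ j _ hij => Finset.disjoint_left.2 fun w hw hw' => hij ?_
    obtain ⟨v, -, rfl⟩ := Finset.mem_image.1 hw
    obtain ⟨v', -, h⟩ := Finset.mem_image.1 hw'
    exact (append_singleton_inj.1 h).2.symm

theorem popSize_zero (c : List ℕ → ℕ) : popSize c 0 = 1 := Finset.card_singleton _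

theorem popSize_succ (c : List ℕ → ℕ) (n : ℕ) :
    popSize c (n + 1) = ∑ i ∈ Finset.range (c []), popSize (subtree c i) n := by
  simp only [popSize]
  rw [← card_biUnion_image_append]
  congr 1
  ext w
  rw [mem_generation_succ_iff_subtree]
  simp

theorem reducedSize_zero (c : List ℕ → ℕ) (n : ℕ) :
    reducedSize c 0 n = if popSize c n = 0 then 0 else 1 := by
  have hiff : (∃ v ∈ generation c n, [] <:+ v) ↔ popSize c n ≠ 0 := by
    simp [popSize, Finset.eq_empty_iff_forall_notMem]
  rw [reducedSize, generation, Finset.filter_singleton, if_congr hiff rfl rfl]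
  split_ifs <;> simp_all

theorem reducedSize_succ_zero (c : List ℕ → ℕ) (m : ℕ) : reducedSize c (m + 1) 0 = 0 := by
  rw [reducedSize, Finset.card_eq_zero, Finset.filter_eq_empty_iff]
  intro w hw
  obtain ⟨u, -, i, -, rfl⟩ := mem_generation_succ.1 hw
  simp [generation]

theorem reducedSize_succ (c : List ℕ → ℕ) (m n : ℕ) :
    reducedSize c (m + 1) (n + 1) =
      ∑ i ∈ Finset.range (c []), reducedSize (subtree c i) m n := by
  simp only [reducedSize]
  rw [← card_biUnion_image_append]
  congr 1
  ext w
  simp only [Finset.mem_filter, Finset.mem_biUnion, Finset.mem_range, Finset.mem_image]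
  constructor
  · rintro ⟨hw, v, hv, t, ht⟩
    obtain ⟨i, hi, w', hw', rfl⟩ := mem_generation_succ_iff_subtree.1 hw
    obtain ⟨j, -, v', hv', rfl⟩ := mem_generation_succ_iff_subtree.1 hv
    rw [← List.append_assoc, append_singleton_inj] at ht
    obtain ⟨ht, rfl⟩ := ht
    exact ⟨i, hi, w', ⟨hw', v', hv', t, ht⟩, rfl⟩
  · rintro ⟨i, hi, w', ⟨hw', v', hv', t, ht⟩, rfl⟩
    exact ⟨mem_generation_succ_iff_subtree.2 ⟨i, hi, w', hw', rfl⟩, v' ++ [i],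
      mem_generation_succ_iff_subtree.2 ⟨i, hi, v', hv', rfl⟩, t, by rw [← ht, List.append_assoc]⟩

theorem reducedSize_eq_zero_iff (c : List ℕ → ℕ) (m k : ℕ) :
    reducedSize c m (m + k) = 0 ↔ popSize c (m + k) = 0 := by
  induction m generalizing c with
  | zero => rw [reducedSize_zero, zero_add]; split_ifs with h <;> simp [h]
  | succ m ih =>
    rw [Nat.succ_add]
    simp [reducedSize_succ, popSize_succ, ih]

/-- The product of `ψ` over the subtrees of the particles of generation `m`. -/
def treeProd (ψ : (List ℕ → ℕ) → ℝ) : ℕ → (List ℕ → ℕ) → ℝ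
  | 0, c => ψ c
  | m + 1, c => ∏ i ∈ Finset.range (c []), treeProd ψ m (subtree c i)

theorem treeProd_mem {ψ : (List ℕ → ℕ) → ℝ} (hψ : ∀ c, ψ c ∈ Set.Icc (0 : ℝ) 1) (m : ℕ)
    (c : List ℕ → ℕ) : treeProd ψ m c ∈ Set.Icc (0 : ℝ) 1 := by
  induction m generalizing c with
  | zero => exact hψ c
  | succ m ih =>
    exact ⟨Finset.prod_nonneg fun i _ => (ih _).1,
      Finset.prod_le_one (fun i _ => (ih _).1) fun i _ => (ih _).2⟩

theorem treeProd_const (s : ℝ) (n : ℕ) (c : List ℕ → ℕ) :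
    treeProd (fun _ => s) n c = s ^ popSize c n := by
  induction n generalizing c with
  | zero => simp [treeProd, popSize_zero]
  | succ n ih => simp only [treeProd, ih, popSize_succ, Finset.prod_pow_eq_pow_sum]

theorem treeProd_pow_popSize_mul_pow_reducedSize (s t : ℝ) (m k : ℕ) (c : List ℕ → ℕ) :
    treeProd (fun c => s ^ popSize c k * t ^ reducedSize c 0 k) m c =
      s ^ popSize c (m + k) * t ^ reducedSize c m (m + k) := by
  induction m generalizing c with
  | zero => simp [treeProd]
  | succ m ih =>
    rw [Nat.succ_add]
    simp only [treeProd, ih, popSize_succ, reducedSize_succ, Finset.prod_mul_distrib,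
      Finset.prod_pow_eq_pow_sum]

end Trees

section Measurability

theorem measurable_subtree (i : ℕ) : Measurable fun c : List ℕ → ℕ => subtree c i :=
  measurable_pi_lambda _ fun _ => measurable_pi_apply _

theorem measurable_apply_root {β : Type*} [MeasurableSpace β] {F : ℕ → (List ℕ → ℕ) → β}
    (hF : ∀ r, Measurable (F r)) : Measurable fun c => F (c []) c :=
  (measurable_from_prod_countable_right hF : Measurable (Function.uncurry F)).comp
    (.prodMk (measurable_pi_apply []) measurable_id)

theorem measurable_treeProd {ψ : (List ℕ → ℕ) → ℝ} (hψ : Measurable ψ) (m : ℕ) :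
    Measurable (treeProd ψ m) := by
  induction m with
  | zero => exact hψ
  | succ m ih =>
    exact measurable_apply_root fun r =>
      Finset.measurable_fun_prod (Finset.range r) fun i _ => ih.comp (measurable_subtree i)

theorem measurable_popSize (n : ℕ) : Measurable fun c => popSize c n := by
  induction n with
  | zero => simp only [popSize_zero, measurable_const]
  | succ n ih =>
    simp only [popSize_succ]
    exact measurable_apply_root fun r =>
      Finset.measurable_fun_sum (Finset.range r) fun i _ => ih.comp (measurable_subtree i)

theorem measurable_reducedSize (m n : ℕ) : Measurable fun c => reducedSize c m n := by
  induction m generalizing n with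
  | zero =>
    simp only [reducedSize_zero]
    exact Measurable.ite (measurable_popSize n (measurableSet_singleton 0)) measurable_const
      measurable_const
  | succ m ih =>
    cases n with
    | zero => simp only [reducedSize_succ_zero, measurable_const]
    | succ n =>
      simp only [reducedSize_succ]
      exact measurable_apply_root fun r =>
        Finset.measurable_fun_sum (Finset.range r) fun i _ => (ih n).comp (measurable_subtree i)

end Measurability

section TreeLaw

theorem indepFun_restrict_of_disjoint {ι Ω : Type*} {E : ι → Type*} [MeasurableSpace Ω]
    [∀ i, MeasurableSpace (E i)] {P : Measure Ω} {X : ∀ i, Ω → E i} (hX : ∀ i, Measurable (X i))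
    (h : iIndepFun X P) {A B : Set ι} (hAB : Disjoint A B) :
    IndepFun (fun ω (i : A) => X i ω) (fun ω (i : B) => X i ω) P := by
  have hle : ∀ S : Set ι, MeasurableSpace.comap (fun ω (i : S) => X i ω) MeasurableSpace.pi ≤
      ⨆ i ∈ S, MeasurableSpace.comap (X i) inferInstance := fun S =>
    Measurable.comap_le <| @measurable_pi_lambda _ _ _ (_) _ _ fun i =>
      (comap_measurable (X i)).mono (le_iSup₂_of_le i.1 i.2 le_rfl) le_rfl
  exact indep_of_indep_of_le_left (indep_of_indep_of_le_right
    (indep_iSup_of_disjoint (fun i => (hX i).comap_le) h hAB) (hle B)) (hle A)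

/-- The law of the offspring numbers of a Galton-Watson tree with offspring law `ν`. -/
noncomputable def treeLaw (ν : Measure ℕ) : Measure (List ℕ → ℕ) :=
  Measure.infinitePi fun _ => ν

variable {ν : Measure ℕ} [IsProbabilityMeasure ν]

instance : IsProbabilityMeasure (treeLaw ν) :=
  inferInstanceAs (IsProbabilityMeasure (Measure.infinitePi _))

theorem map_subtree_treeLaw :
    (treeLaw ν).map subtree = Measure.infinitePi fun _ : ℕ => treeLaw ν := by
  have hinj : Function.Injective fun p : ℕ × List ℕ => p.2 ++ [p.1] := fun p q h =>
    Prod.ext (append_singleton_inj.1 h).2 (append_singleton_inj.1 h).1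
  have hflat := Measure.map_infinitePi_infinitePi_of_inj (P := fun _ : List ℕ => ν) hinj
  have hcurry := Measure.infinitePi_map_curry fun (_ : ℕ) (_ : List ℕ) => ν
  rw [← hflat, Measure.map_map (by fun_prop) (by fun_prop)] at hcurry
  exact hcurry

theorem map_root_subtree_treeLaw :
    (treeLaw ν).map (fun c => (c [], subtree c)) =
      ν.prod (Measure.infinitePi fun _ : ℕ => treeLaw ν) := by
  have hsub : Measurable subtree := measurable_pi_lambda _ measurable_subtree
  have hindep : IndepFun (fun c : List ℕ → ℕ => c []) subtree (treeLaw ν) := by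
    have hrest := indepFun_restrict_of_disjoint (X := fun u (c : List ℕ → ℕ) => c u)
      (fun u => measurable_pi_apply u)
      (iIndepFun_infinitePi (P := fun _ : List ℕ => ν) fun _ => measurable_id)
      (disjoint_compl_right : Disjoint {[]} {([] : List ℕ)}ᶜ)
    have hroot : Measurable fun c : ({[]} : Set (List ℕ)) → ℕ => c ⟨[], rfl⟩ :=
      measurable_pi_apply _
    have hrest' : Measurable fun (c : ({[]}ᶜ : Set (List ℕ)) → ℕ) (i : ℕ) (u : List ℕ) =>
        c ⟨u ++ [i], by simp⟩ :=
      measurable_pi_lambda _ fun _ => measurable_pi_lambda _ fun _ => measurable_pi_apply _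
    exact hrest.comp hroot hrest'
  rw [hindep.map_prod_eq_prod_map_map (measurable_pi_apply _).aemeasurable hsub.aemeasurable,
    map_subtree_treeLaw, treeLaw, Measure.infinitePi_map_eval]

theorem integral_prod_range_infinitePi {E : Type*} [MeasurableSpace E] {μ : Measure E}
    [IsProbabilityMeasure μ] {F : E → ℝ} (hF : Measurable F) (r : ℕ) :
    ∫ z : ℕ → E, ∏ i ∈ Finset.range r, F (z i) ∂Measure.infinitePi (fun _ => μ) =
      (∫ c, F c ∂μ) ^ r := by
  have hindep := (iIndepFun_infinitePi (P := fun _ : ℕ => μ) fun _ => hF).precomp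
    (Fin.val_injective (n := r))
  have heval : ∀ i : ℕ, ∫ z : ℕ → E, F (z i) ∂Measure.infinitePi (fun _ => μ) = ∫ c, F c ∂μ :=
    fun i => by
      rw [← integral_map (φ := fun z : ℕ → E => z i)
        (measurable_pi_apply i).aemeasurable hF.aestronglyMeasurable,
        Measure.infinitePi_map_eval]
  simp only [Finset.prod_range]
  rw [hindep.integral_fun_prod_eq_prod_integral fun i =>
    (hF.comp (measurable_pi_apply _)).aestronglyMeasurable]
  simp [heval]

theorem integral_prod_subtree {F : (List ℕ → ℕ) → ℝ} (hF : Measurable F)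
    (hF1 : ∀ c, F c ∈ Set.Icc (0 : ℝ) 1) :
    ∫ c, ∏ i ∈ Finset.range (c []), F (subtree c i) ∂treeLaw ν =
      genFun ν (∫ c, F c ∂treeLaw ν) := by
  set H : ℕ × (ℕ → List ℕ → ℕ) → ℝ := fun p => ∏ i ∈ Finset.range p.1, F (p.2 i)
  have hH : Measurable H := measurable_from_prod_countable_right fun r =>
    Finset.measurable_fun_prod (Finset.range r) fun i _ => hF.comp (measurable_pi_apply i)
  have hbound : ∀ p, ‖H p‖ ≤ 1 := fun p => by
    rw [Real.norm_of_nonneg (Finset.prod_nonneg fun i _ => (hF1 _).1)]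
    exact Finset.prod_le_one (fun i _ => (hF1 _).1) fun i _ => (hF1 _).2
  have hsub : Measurable fun c : List ℕ → ℕ => (c [], subtree c) :=
    (measurable_pi_apply []).prodMk (measurable_pi_lambda _ measurable_subtree)
  calc ∫ c, H (c [], subtree c) ∂treeLaw ν
      = ∫ p, H p ∂ν.prod (Measure.infinitePi fun _ : ℕ => treeLaw ν) := by
        rw [← map_root_subtree_treeLaw, integral_map hsub.aemeasurable hH.aestronglyMeasurable]
    _ = ∫ r, ∫ z, H (r, z) ∂Measure.infinitePi (fun _ : ℕ => treeLaw ν) ∂ν :=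
        integral_prod _ (.of_bound hH.aestronglyMeasurable 1 (.of_forall hbound))
    _ = genFun ν (∫ c, F c ∂treeLaw ν) := by
        simp only [H, integral_prod_range_infinitePi hF, genFun]

theorem integral_treeProd {ψ : (List ℕ → ℕ) → ℝ} (hψ : Measurable ψ)
    (hψ1 : ∀ c, ψ c ∈ Set.Icc (0 : ℝ) 1) (m : ℕ) :
    ∫ c, treeProd ψ m c ∂treeLaw ν = (genFun ν)^[m] (∫ c, ψ c ∂treeLaw ν) := by
  induction m with
  | zero => rfl
  | succ m ih =>
    rw [Function.iterate_succ_apply', ← ih]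
    exact integral_prod_subtree (measurable_treeProd hψ m) (treeProd_mem hψ1 m)

theorem integral_pow_popSize {s : ℝ} (hs : s ∈ Set.Icc (0 : ℝ) 1) (n : ℕ) :
    ∫ c, s ^ popSize c n ∂treeLaw ν = (genFun ν)^[n] s := by
  simpa [treeProd_const] using
    integral_treeProd (ν := ν) (ψ := fun _ => s) measurable_const (fun _ => hs) n

theorem measurable_pow_popSize (s : ℝ) (n : ℕ) : Measurable fun c => s ^ popSize c n :=
  (measurable_from_nat (f := fun j => s ^ j)).comp (measurable_popSize n)

theorem integrable_pow_popSize {s : ℝ} (hs : s ∈ Set.Icc (0 : ℝ) 1) (n : ℕ) :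
    Integrable (fun c => s ^ popSize c n) (treeLaw ν) := by
  refine .of_bound (measurable_pow_popSize s n).aestronglyMeasurable 1 (.of_forall fun c => ?_)
  rw [Real.norm_of_nonneg (pow_nonneg hs.1 _)]
  exact pow_le_one₀ hs.1 hs.2

theorem integral_pow_popSize_mul_pow_reducedSize {s t : ℝ} (hs : s ∈ Set.Icc (0 : ℝ) 1)
    (ht : t ∈ Set.Icc (0 : ℝ) 1) (m k : ℕ) :
    ∫ c, s ^ popSize c (m + k) * t ^ reducedSize c m (m + k) ∂treeLaw ν =
      (genFun ν)^[m] ((genFun ν)^[k] 0 + t * ((genFun ν)^[k] s - (genFun ν)^[k] 0)) := by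
  have h0 : (0 : ℝ) ∈ Set.Icc (0 : ℝ) 1 := ⟨le_rfl, zero_le_one⟩
  have hroot : ∀ c : List ℕ → ℕ, s ^ popSize c k * t ^ reducedSize c 0 k =
      (1 - t) * 0 ^ popSize c k + t * s ^ popSize c k := fun c => by
    rw [reducedSize_zero]
    split_ifs with h <;> simp [h, mul_comm]
  have hψ : Measurable fun c => s ^ popSize c k * t ^ reducedSize c 0 k :=
    (measurable_pow_popSize s k).mul
      ((measurable_from_nat (f := fun j => t ^ j)).comp (measurable_reducedSize 0 k))
  have := integral_treeProd (ν := ν) hψ (fun c => ⟨mul_nonneg (pow_nonneg hs.1 _)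
    (pow_nonneg ht.1 _), mul_le_one₀ (pow_le_one₀ hs.1 hs.2) (pow_nonneg ht.1 _)
    (pow_le_one₀ ht.1 ht.2)⟩) m
  simp only [treeProd_pow_popSize_mul_pow_reducedSize] at this
  simp only [this, hroot]
  rw [integral_add ((integrable_pow_popSize h0 k).const_mul _)
    ((integrable_pow_popSize hs k).const_mul _), integral_const_mul, integral_const_mul,
    integral_pow_popSize h0, integral_pow_popSize hs]
  congr 1
  ring

end TreeLaw

section Survival

/-- The generating function in the coordinate `q = 1 - s`; its `n`-th iterate at `1` is the
probability that the process survives to generation `n`. -/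
noncomputable def survival (ν : Measure ℕ) (q : ℝ) : ℝ := 1 - genFun ν (1 - q)

theorem genFun_iterate (ν : Measure ℕ) (n : ℕ) (s : ℝ) :
    (genFun ν)^[n] s = 1 - (survival ν)^[n] (1 - s) := by
  induction n with
  | zero => simp
  | succ n ih =>
    rw [Function.iterate_succ_apply', Function.iterate_succ_apply', ih, survival, sub_sub_cancel]

variable {ν : Measure ℕ}

theorem integrable_pow [IsFiniteMeasure ν] {s : ℝ} (hs : s ∈ Set.Icc (0 : ℝ) 1) :
    Integrable (fun k : ℕ => s ^ k) ν := by
  refine .of_bound measurable_from_nat.aestronglyMeasurable 1 (.of_forall fun k => ?_)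
  rw [Real.norm_of_nonneg (pow_nonneg hs.1 _)]
  exact pow_le_one₀ hs.1 hs.2

theorem monotoneOn_genFun [IsFiniteMeasure ν] : MonotoneOn (genFun ν) (Set.Icc 0 1) :=
  fun _ hs _ ht hst =>
    integral_mono (integrable_pow hs) (integrable_pow ht) fun _ => pow_le_pow_left₀ hs.1 hst _

theorem convexOn_genFun [IsFiniteMeasure ν] : ConvexOn ℝ (Set.Icc 0 1) (genFun ν) := by
  refine ⟨convex_Icc 0 1, fun s hs t ht a b ha hb hab => ?_⟩
  simp only [genFun, smul_eq_mul, ← integral_const_mul]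
  rw [← integral_add ((integrable_pow hs).const_mul a) ((integrable_pow ht).const_mul b)]
  exact integral_mono (integrable_pow (convex_Icc 0 1 hs ht ha hb hab))
    (((integrable_pow hs).const_mul a).add ((integrable_pow ht).const_mul b))
    fun k => (convexOn_pow k).2 hs.1 ht.1 ha hb hab

theorem one_sub_mem_Icc {q : ℝ} (hq : q ∈ Set.Icc (0 : ℝ) 1) : 1 - q ∈ Set.Icc (0 : ℝ) 1 :=
  ⟨sub_nonneg.2 hq.2, sub_le_self _ hq.1⟩

theorem survival_zero [IsProbabilityMeasure ν] : survival ν 0 = 0 := by simp [survival, genFun]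

theorem monotoneOn_survival [IsFiniteMeasure ν] : MonotoneOn (survival ν) (Set.Icc 0 1) :=
  fun _ hp _ hq hpq => sub_le_sub_left (monotoneOn_genFun (one_sub_mem_Icc hq) (one_sub_mem_Icc hp)
    (sub_le_sub_left hpq 1)) 1

theorem concaveOn_survival [IsFiniteMeasure ν] : ConcaveOn ℝ (Set.Icc 0 1) (survival ν) := by
  refine ⟨convex_Icc 0 1, fun p hp q hq a b ha hb hab => ?_⟩
  have hconv := (convexOn_genFun (ν := ν)).2 (one_sub_mem_Icc hp) (one_sub_mem_Icc hq) ha hb hab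
  have harg : a • (1 - p) + b • (1 - q) = 1 - (a • p + b • q) := by
    simp only [smul_eq_mul]
    linear_combination hab
  rw [harg] at hconv
  simp only [survival, smul_eq_mul] at hconv ⊢
  linarith

theorem CriticalOffspring.relDecr_survival {α : ℝ} {L : ℝ → ℝ} (hν : CriticalOffspring α L ν)
    {q : ℝ} (hq : q ∈ Set.Ioc (0 : ℝ) 1) : relDecr (survival ν) q = q ^ α * L q := by
  have := hq.1.ne'
  rw [relDecr, survival, hν.genFun_eq _ (sub_nonneg.2 hq.2) (sub_le_self _ hq.1.le),
    sub_sub_cancel, Real.rpow_add hq.1, Real.rpow_one]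
  field_simp
  ring

theorem CriticalOffspring.isCriticalStep_survival [IsProbabilityMeasure ν] {α : ℝ} {L : ℝ → ℝ}
    (hν : CriticalOffspring α L ν) (hα : 0 < α) : IsCriticalStep α (survival ν) := by
  have hreg : RegularlyVaryingAtZero α (relDecr (survival ν)) :=
    (hν.slowlyVarying.rpow_mul α).congr <|
      Filter.mem_of_superset (Ioc_mem_nhdsGT one_pos) fun q hq => (hν.relDecr_survival hq).symm
  have hmono := monotoneOn_relDecr_of_concaveOn concaveOn_survival (survival_zero (ν := ν))
  refine ⟨survival_zero, fun q hq => ?_, fun q hq => ?_, monotoneOn_survival, concaveOn_survival,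
    hreg⟩
  · obtain ⟨p, hp1, hp⟩ := (((hreg.tendsto_zero hα hmono).eventually (gt_mem_nhds one_pos)).and
      (Ioc_mem_nhdsGT hq.1)).exists
    have hpos : 0 < survival ν p := by
      rw [eq_mul_one_sub_relDecr (survival ν) hp.1.ne']
      exact mul_pos hp.1 (sub_pos.2 hp1)
    exact hpos.trans_le <| monotoneOn_survival ⟨hp.1.le, hp.2.trans hq.2⟩
      (Set.Ioc_subset_Icc_self hq) hp.2
  · have := hreg.pos hmono hq
    rwa [relDecr, sub_pos, div_lt_one hq.1] at this

end Survival

section SurvivingTree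

variable {ν : Measure ℕ} {s : ℝ} {n : ℕ}

/-- The restriction of the law of the tree to the event that generation `n` is not empty. -/
noncomputable def survivingTreeLaw (ν : Measure ℕ) (n : ℕ) : Measure (List ℕ → ℕ) :=
  (treeLaw ν).restrict {c | popSize c n ≠ 0}

theorem measurableSet_popSize_ne_zero (n : ℕ) : MeasurableSet {c | popSize c n ≠ 0} :=
  measurable_popSize n (measurableSet_singleton 0).compl

variable [IsProbabilityMeasure ν]

instance : IsFiniteMeasure (survivingTreeLaw ν n) :=
  inferInstanceAs (IsFiniteMeasure (Measure.restrict _ _))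

theorem integral_pow_mul_pow_survivingTreeLaw {t : ℝ} {p k : ℕ} (hs : s ∈ Set.Icc (0 : ℝ) 1)
    (ht : t ∈ Set.Icc (0 : ℝ) 1) (hn : p + k = n) :
    ∫ c, s ^ popSize c n * t ^ reducedSize c p n ∂survivingTreeLaw ν n =
      (survival ν)^[p] ((survival ν)^[k] 1) - (survival ν)^[p] ((survival ν)^[k] 1 -
        t * ((survival ν)^[k] 1 - (survival ν)^[k] (1 - s))) := by
  subst hn
  have h0 : (0 : ℝ) ∈ Set.Icc (0 : ℝ) 1 := ⟨le_rfl, zero_le_one⟩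
  have hint : Integrable (fun c => s ^ popSize c (p + k) * t ^ reducedSize c p (p + k))
      (treeLaw ν) := by
    refine .of_bound ((measurable_pow_popSize s _).mul ((measurable_from_nat
      (f := fun j => t ^ j)).comp (measurable_reducedSize _ _))).aestronglyMeasurable 1
      (.of_forall fun c => ?_)
    rw [Real.norm_of_nonneg (mul_nonneg (pow_nonneg hs.1 _) (pow_nonneg ht.1 _))]
    exact mul_le_one₀ (pow_le_one₀ hs.1 hs.2) (pow_nonneg ht.1 _) (pow_le_one₀ ht.1 ht.2)
  have hindicator : ∀ c, {c | popSize c (p + k) ≠ 0}.indicator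
      (fun c => s ^ popSize c (p + k) * t ^ reducedSize c p (p + k)) c =
      s ^ popSize c (p + k) * t ^ reducedSize c p (p + k) - 0 ^ popSize c (p + k) := fun c => by
    by_cases h : popSize c (p + k) = 0
    · simp [h, (reducedSize_eq_zero_iff c p k).2 h]
    · simp [h]
  rw [survivingTreeLaw, ← integral_indicator (measurableSet_popSize_ne_zero _)]
  simp only [hindicator]
  rw [integral_sub hint (integrable_pow_popSize h0 _),
    integral_pow_popSize_mul_pow_reducedSize hs ht, integral_pow_popSize h0,
    Function.iterate_add_apply, genFun_iterate ν p, genFun_iterate ν p, genFun_iterate ν k,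
    genFun_iterate ν k, sub_zero]
  ring_nf

theorem integral_pow_survivingTreeLaw (hs : s ∈ Set.Icc (0 : ℝ) 1) :
    ∫ c, s ^ popSize c n ∂survivingTreeLaw ν n =
      (survival ν)^[n] 1 - (survival ν)^[n] (1 - s) := by
  simpa using integral_pow_mul_pow_survivingTreeLaw (ν := ν) (p := 0) hs
    ⟨zero_le_one, le_rfl⟩ (zero_add n)

end SurvivingTree

section NegBinCoeff

/-- The coefficient `Γ(j + α) / (Γ(α) j!)` of `z ^ j` in `(1 - z) ^ (-α)`. -/
noncomputable def negBinCoeff (α : ℝ) (j : ℕ) : ℝ :=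
  Real.Gamma (j + α) / (Real.Gamma α * j.factorial)

variable {α : ℝ}

theorem negBinCoeff_pos (hα : 0 < α) (j : ℕ) : 0 < negBinCoeff α j :=
  div_pos (Real.Gamma_pos_of_pos (by positivity))
    (mul_pos (Real.Gamma_pos_of_pos hα) (by positivity))

theorem negBinCoeff_zero (hα : 0 < α) : negBinCoeff α 0 = 1 := by
  simp [negBinCoeff, (Real.Gamma_pos_of_pos hα).ne']

theorem Gamma_natCast_add (hα : 0 < α) (n : ℕ) :
    Real.Gamma (n + α) = (ascPochhammer ℝ n).eval α * Real.Gamma α := by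
  induction n with
  | zero => simp
  | succ n ih =>
    rw [Nat.cast_succ, add_right_comm, Real.Gamma_add_one (by positivity), ih,
      ascPochhammer_succ_eval]
    ring

theorem choose_eq_negBinCoeff (hα : 0 < α) (n : ℕ) :
    Ring.choose (α + n - 1) n = negBinCoeff α n := by
  have h1 : Ring.choose (α + n - 1) n = Ring.multichoose α n := by
    rw [Ring.choose]
    congr 1
    ring
  have h2 := Ring.factorial_nsmul_multichoose_eq_ascPochhammer α n
  rw [Polynomial.ascPochhammer_smeval_eq_eval, nsmul_eq_mul] at h2
  have := (Real.Gamma_pos_of_pos hα).ne'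
  rw [h1, negBinCoeff, Gamma_natCast_add hα, ← h2]
  field_simp

theorem hasSum_negBinCoeff {z : ℝ} (hα : 0 < α) (hz : |z| < 1) :
    HasSum (fun j => negBinCoeff α j * z ^ j) ((1 - z) ^ (-α)) := by
  have h := (Real.one_div_one_sub_rpow_hasFPowerSeriesOnBall_zero α).hasSum (y := z)
    (by simpa [enorm_eq_nnnorm] using! hz)
  rw [zero_add] at h
  rw [Real.rpow_neg (by linarith [(abs_lt.1 hz).2]), ← one_div]
  exact h.congr_fun fun j => by simp [choose_eq_negBinCoeff hα, mul_comm]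

end NegBinCoeff

/-! ### The limit measures -/

section PowerLaw

variable {α c : ℝ}

/-- The measure on `(0, ∞)` with density `y ^ (α - 1) / Γ(α)`, whose Laplace transform is
`c ^ (-α)`. -/
noncomputable def powerLaw (α : ℝ) : Measure ℝ :=
  (volume.restrict (Set.Ioi 0)).withDensity fun y => ENNReal.ofReal (y ^ (α - 1) / Real.Gamma α)

theorem integral_powerLaw (hα : 0 < α) (f : ℝ → ℝ) :
    ∫ y, f y ∂powerLaw α = ∫ y in Set.Ioi 0, y ^ (α - 1) / Real.Gamma α * f y := by
  rw [powerLaw, integral_withDensity_eq_integral_toReal_smul (by fun_prop)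
    (.of_forall fun _ => ENNReal.ofReal_lt_top)]
  refine setIntegral_congr_fun measurableSet_Ioi fun y hy => ?_
  have := Real.rpow_pos_of_pos hy (α - 1)
  have := Real.Gamma_pos_of_pos hα
  rw [ENNReal.toReal_ofReal (by positivity), smul_eq_mul]

theorem integral_exp_powerLaw (hα : 0 < α) (hc : 0 < c) :
    ∫ y, Real.exp (-(c * y)) ∂powerLaw α = c ^ (-α) := by
  have hΓ := (Real.Gamma_pos_of_pos hα).ne'
  simp only [integral_powerLaw hα, div_mul_eq_mul_div]
  rw [integral_div, Real.integral_rpow_mul_exp_neg_mul_Ioi hα hc, mul_div_cancel_right₀ _ hΓ,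
    one_div, Real.inv_rpow hc.le, Real.rpow_neg hc.le]

theorem isLaplaceMeasure_powerLaw (hα : 0 < α) : IsLaplaceMeasure (powerLaw α) where
  ae_nonneg := (withDensity_absolutelyContinuous _ _).ae_le <|
    (ae_restrict_mem measurableSet_Ioi).mono fun _ hy => le_of_lt hy
  integrable_exp_neg := .of_integral_ne_zero <| by
    simpa using (integral_exp_powerLaw hα one_pos).trans_ne (by simp)

theorem powerLaw_singleton (α y : ℝ) : powerLaw α {y} = 0 :=
  withDensity_absolutelyContinuous _ _ (measure_singleton y)

theorem powerLaw_real_Iic_one (hα : 0 < α) :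
    (powerLaw α).real (Set.Iic 1) = 1 / Real.Gamma (α + 1) := by
  have hΓ := (Real.Gamma_pos_of_pos hα).ne'
  rw [← integral_indicator_one measurableSet_Iic, integral_powerLaw hα]
  have hind : ∀ y : ℝ, y ^ (α - 1) / Real.Gamma α * (Set.Iic (1 : ℝ)).indicator 1 y =
      (Set.Iic (1 : ℝ)).indicator (fun y => y ^ (α - 1) / Real.Gamma α) y := fun y => by
    by_cases hy : y ∈ Set.Iic (1 : ℝ) <;> simp [hy]
  simp only [hind]
  rw [setIntegral_indicator measurableSet_Iic, Set.Ioi_inter_Iic,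
    ← intervalIntegral.integral_of_le zero_le_one, intervalIntegral.integral_div,
    integral_rpow (.inl (by linarith)), Real.Gamma_add_one hα.ne', sub_add_cancel,
    Real.zero_rpow hα.ne', Real.one_rpow]
  field_simp
  ring

end PowerLaw

section Coefficients

variable {ι X : Type*} {l : Filter ι} [MeasurableSpace X]

theorem tendsto_setIntegral_eq_of_tendsto_integral_mul_pow {μ : ι → Measure X} {W : ι → X → ℝ}
    (hW : ∀ i, Integrable (W i) (μ i)) (hW0 : ∀ i y, 0 ≤ W i y) {R : ι → X → ℕ}
    (hR : ∀ i, Measurable (R i)) {w : ℕ → ℝ} (hw : ∀ j, 0 ≤ w j) {F : ℝ → ℝ}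
    (hF : ∀ t ∈ Set.Icc (0 : ℝ) 1, HasSum (fun j => w j * t ^ j) (F t))
    (hlim : ∀ t ∈ Set.Ico (0 : ℝ) 1,
      Tendsto (fun i => ∫ y, W i y * t ^ R i y ∂μ i) l (𝓝 (F t)))
    (j : ℕ) : Tendsto (fun i => ∫ y in {y | R i y = j}, W i y ∂μ i) l (𝓝 (w j)) := by
  let ρ' : Measure ℕ := Measure.count.withDensity fun i => ENNReal.ofReal (w i)
  have hsum : Summable w := by simpa using (hF 1 ⟨zero_le_one, le_rfl⟩).summable
  have : IsFiniteMeasure ρ' := isFiniteMeasure_withDensity_ofReal (by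
    rw [HasFiniteIntegral]
    simpa [lintegral_count, ← ofReal_norm, abs_of_nonneg, hw] using! hsum.tsum_ofReal_lt_top)
  have hρ' : ∀ i, ρ'.real {i} = w i := fun i => by
    simp [ρ', Measure.real, withDensity_apply, hw]
  let ρ : ι → Measure ℕ := fun i => ((μ i).withDensity fun y => ENNReal.ofReal (W i y)).map (R i)
  have : ∀ i, IsFiniteMeasure (ρ i) := fun i => by
    have := isFiniteMeasure_withDensity_ofReal (hW i).2
    infer_instance
  have hρ : ∀ i, (ρ i).real {j} = ∫ y in {y | R i y = j}, W i y ∂μ i := fun i => by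
    have hset : MeasurableSet (R i ⁻¹' {j}) := hR i (measurableSet_singleton j)
    rw [map_measureReal_apply (hR i) (measurableSet_singleton j), Measure.real,
      withDensity_apply _ hset, ← ofReal_integral_eq_lintegral_ofReal (hW i).integrableOn
        (.of_forall (hW0 i)), ENNReal.toReal_ofReal (integral_nonneg (hW0 i))]
    rfl
  suffices Tendsto (fun i => (ρ i).real {j}) l (𝓝 (ρ'.real {j})) by simpa only [hρ, hρ'] using this
  refine tendsto_measureReal_singleton_nat (fun k => ?_) j
  have hpow : ∀ i : ℕ, Real.exp (-((k + 1 : ℕ) * i)) = Real.exp (-(k + 1 : ℕ)) ^ i :=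
    fun i => by rw [← Real.exp_nat_mul]; ring_nf
  have hmem : Real.exp (-(k + 1 : ℕ)) ∈ Set.Ico (0 : ℝ) 1 :=
    ⟨(Real.exp_pos _).le, Real.exp_lt_one_iff.2 (neg_lt_zero.2 (by positivity))⟩
  have hint : ∫ i, Real.exp (-(k + 1 : ℕ)) ^ i ∂ρ' = F (Real.exp (-(k + 1 : ℕ))) := by
    rw [integral_countable (integrable_pow (Set.Ico_subset_Icc_self hmem)),
      ← (hF _ (Set.Ico_subset_Icc_self hmem)).tsum_eq]
    simp [hρ']
  simp only [hpow, hint]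
  refine (hlim _ hmem).congr fun i => ?_
  rw [integral_map (hR i).aemeasurable measurable_from_nat.aestronglyMeasurable,
    integral_withDensity_eq_integral_toReal_smul₀ (hW i).aemeasurable.ennreal_ofReal
    (.of_forall fun _ => ENNReal.ofReal_lt_top)]
  simp [hW0]

end Coefficients

section Convolution

variable {M : Measure ℝ}

instance isFiniteMeasure_convPow [IsFiniteMeasure M] (j : ℕ) : IsFiniteMeasure (convPow M j) := by
  induction j with
  | zero => rw [convPow]; infer_instance
  | succ j ih => rw [convPow]; infer_instance

theorem ae_nonneg_convPow (h : ∀ᵐ y ∂M, 0 ≤ y) (j : ℕ) : ∀ᵐ y ∂convPow M j, 0 ≤ y := by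
  induction j with
  | zero => simp [convPow, ae_dirac_eq]
  | succ j ih =>
    rw [convPow, Measure.conv, ae_map_iff (by fun_prop) measurableSet_Ici]
    filter_upwards [Measure.quasiMeasurePreserving_fst.ae ih,
      Measure.quasiMeasurePreserving_snd.ae h] with z h1 h2
    exact add_nonneg h1 h2

theorem integral_exp_convPow [IsFiniteMeasure M] (c : ℝ) (j : ℕ) :
    ∫ y, Real.exp (-(c * y)) ∂convPow M j = (∫ y, Real.exp (-(c * y)) ∂M) ^ j := by
  induction j with
  | zero => simp [convPow]
  | succ j ih =>
    rw [convPow, Measure.conv, integral_map (by fun_prop) (by fun_prop), pow_succ, ← ih,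
      ← integral_prod_mul]
    simp only [← Real.exp_add]
    ring_nf

end Convolution

section SlackLaw

variable {α x c : ℝ}

/-- The Laplace transform at `c` of the dilation by `x ^ (1 / α)` of the law with Laplace
transform `1 - (1 + c ^ (-α)) ^ (-1 / α)`. -/
noncomputable def slackLaplace (α x c : ℝ) : ℝ := 1 - (1 + c ^ (-α) / x) ^ (-(1 / α))

theorem slackLaplace_mem (hα : 0 < α) (hx : 0 < x) (hc : 0 < c) :
    slackLaplace α x c ∈ Set.Ico (0 : ℝ) 1 := by
  have hone : 1 ≤ 1 + c ^ (-α) / x := le_add_of_nonneg_right (by positivity)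
  have hle := Real.rpow_le_one_of_one_le_of_nonpos hone (neg_nonpos.2 (by positivity : 0 ≤ 1 / α))
  exact ⟨sub_nonneg.2 hle, sub_lt_self _ (Real.rpow_pos_of_pos (by positivity) _)⟩

theorem tendsto_slackLaplace_zero (hα : 0 < α) (hx : 0 < x) :
    Tendsto (slackLaplace α x) (𝓝[>] 0) (𝓝 1) := by
  have hneg : Tendsto (fun c : ℝ => 1 + c ^ (-α) / x) (𝓝[>] 0) atTop :=
    tendsto_atTop_add_const_left _ _
      ((tendsto_rpow_neg_nhdsGT_zero (neg_lt_zero.2 hα)).atTop_div_const hx)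
  have := ((tendsto_rpow_neg_atTop (one_div_pos.2 hα)).comp hneg).const_sub 1
  rwa [sub_zero] at this

theorem isSlackLaw_iff {M : Measure ℝ} : IsSlackLaw α M ↔ IsProbabilityMeasure M ∧
    (∀ᵐ y ∂M, 0 ≤ y) ∧ ∀ c, 0 < c → ∫ y, Real.exp (-(c * y)) ∂M = slackLaplace α 1 c := by
  have hnonneg : M (Set.Iio 0) = 0 ↔ ∀ᵐ y ∂M, 0 ≤ y := by simp [ae_iff, Set.Iio_def]
  have hlaplace : ∀ c : ℝ, 0 < c →
      1 - 1 / (1 + c ^ (-α)) ^ (1 / α) = slackLaplace α 1 c := fun c hc => by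
    rw [slackLaplace, div_one, Real.rpow_neg (x := 1 + c ^ (-α)) (by positivity), one_div (_ ^ _)]
  rw [← hnonneg]
  exact ⟨fun h => ⟨h.prob, h.nonneg, fun c hc => (h.laplace c hc).trans (hlaplace c hc)⟩,
    fun h => ⟨h.1, h.2.1, fun c hc => (h.2.2 c hc).trans (hlaplace c hc).symm⟩⟩

namespace IsSlackLaw

variable {M M' : Measure ℝ}

theorem isLaplaceMeasure (hM : IsSlackLaw α M) : IsLaplaceMeasure M :=
  have := hM.prob
  .of_ae_nonneg (isSlackLaw_iff.1 hM).2.1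

theorem unique (hM : IsSlackLaw α M) (hM' : IsSlackLaw α M') : M = M' :=
  have := hM.prob
  hM.isLaplaceMeasure.ext hM'.isLaplaceMeasure fun k =>
    (hM.laplace _ (by positivity)).trans (hM'.laplace _ (by positivity)).symm

theorem integral_exp_mul_rpow (hM : IsSlackLaw α M) (hα : 0 < α) (hx : 0 < x) (hc : 0 < c) :
    ∫ y, Real.exp (-(c * x ^ (1 / α) * y)) ∂M = slackLaplace α x c := by
  have hrpow : (c * x ^ (1 / α)) ^ (-α) = c ^ (-α) / x := by
    rw [Real.mul_rpow hc.le (by positivity), ← Real.rpow_mul hx.le, one_div_mul_eq_div, neg_div,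
      div_self hα.ne', Real.rpow_neg_one, div_eq_mul_inv]
  rw [(isSlackLaw_iff.1 hM).2.2 _ (by positivity), slackLaplace, hrpow, div_one, slackLaplace]

end IsSlackLaw

end SlackLaw

/-! ### Conditioning on a small population -/

section ScaledPopLaw

variable {ν : Measure ℕ} {a b c : ℝ} {n : ℕ} {B : Set (List ℕ → ℕ)}

/-- The law of `a * Z(n)` on the part of the event `B` where generation `n` is not empty,
with total mass divided by `b`. -/
noncomputable def scaledPopLaw (ν : Measure ℕ) (a b : ℝ) (n : ℕ) (B : Set (List ℕ → ℕ)) :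
    Measure ℝ :=
  b⁻¹.toNNReal • ((survivingTreeLaw ν n).restrict B).map fun t => a * (popSize t n : ℝ)

theorem measurable_const_mul_popSize (a : ℝ) (n : ℕ) :
    Measurable fun t => a * (popSize t n : ℝ) :=
  (measurable_from_nat (f := fun i : ℕ => a * (i : ℝ))).comp (measurable_popSize n)

instance [IsProbabilityMeasure ν] : IsFiniteMeasure (scaledPopLaw ν a b n B) := by
  rw [scaledPopLaw]
  infer_instance

theorem isLaplaceMeasure_scaledPopLaw [IsProbabilityMeasure ν] (ha : 0 ≤ a) :
    IsLaplaceMeasure (scaledPopLaw ν a b n B) :=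
  .of_ae_nonneg <| Measure.ae_smul_measure
    ((ae_map_iff (measurable_const_mul_popSize a n).aemeasurable measurableSet_Ici).2 <|
      .of_forall fun _ => by positivity) _

theorem scaledPopLaw_le_univ : scaledPopLaw ν a b n B ≤ scaledPopLaw ν a b n Set.univ :=
  Measure.le_iff'.2 fun s => by
    simp only [scaledPopLaw, Measure.smul_apply]
    exact smul_le_smul_of_nonneg_left (Measure.map_mono
      (Measure.restrict_mono (Set.subset_univ B) le_rfl) (measurable_const_mul_popSize a n) s)
      zero_le

theorem integral_exp_scaledPopLaw (hb : 0 ≤ b) :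
    ∫ y, Real.exp (-(c * y)) ∂scaledPopLaw ν a b n B =
      (∫ t in B, Real.exp (-(c * a)) ^ popSize t n ∂survivingTreeLaw ν n) / b := by
  have hpow : ∀ i : ℕ, Real.exp (-(c * (a * i))) = Real.exp (-(c * a)) ^ i :=
    fun i => by rw [← Real.exp_nat_mul]; ring_nf
  rw [scaledPopLaw, integral_smul_nnreal_measure,
    integral_map (measurable_const_mul_popSize a n).aemeasurable (by fun_prop), NNReal.smul_def,
    Real.coe_toNNReal _ (inv_nonneg.2 hb), smul_eq_mul, inv_mul_eq_div]
  simp only [hpow]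

theorem integral_exp_scaledPopLaw_univ [IsProbabilityMeasure ν] (hb : 0 ≤ b) (ha : 0 ≤ a)
    (hc : 0 ≤ c) :
    ∫ y, Real.exp (-(c * y)) ∂scaledPopLaw ν a b n Set.univ =
      ((survival ν)^[n] 1 - (survival ν)^[n] (1 - Real.exp (-(c * a)))) / b := by
  rw [integral_exp_scaledPopLaw hb, setIntegral_univ, integral_pow_survivingTreeLaw]
  exact ⟨(Real.exp_pos _).le, Real.exp_le_one_iff.2 (neg_nonpos.2 (by positivity))⟩

theorem mem_smallDev_iff {k : ℕ} (hk : 0 < (survival ν)^[k] 1) {t : List ℕ → ℕ} :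
    t ∈ smallDev ν (fun u t => t u) k n ↔
      popSize t n ≠ 0 ∧ (survival ν)^[k] 1 * (popSize t n : ℝ) ≤ 1 := by
  rw [smallDev, Set.mem_ofPred_eq, genFun_iterate, sub_zero, sub_sub_cancel,
    mul_pos_iff_of_pos_left hk, Nat.cast_pos, pos_iff_ne_zero]

theorem measurableSet_smallDev (k : ℕ) :
    MeasurableSet (smallDev ν (fun u (t : List ℕ → ℕ) => t u) k n) :=
  (measurableSet_lt measurable_const (measurable_const_mul_popSize _ n)).inter
    (measurableSet_le (measurable_const_mul_popSize _ n) measurable_const)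

theorem scaledPopLaw_real_Iic_one (hb : 0 ≤ b) {k : ℕ} (hk : 0 < (survival ν)^[k] 1)
    (hB : MeasurableSet B) :
    (scaledPopLaw ν ((survival ν)^[k] 1) b n B).real (Set.Iic 1) =
      (treeLaw ν).real (smallDev ν (fun u t => t u) k n ∩ B) / b := by
  have hmeas := measurable_const_mul_popSize ((survival ν)^[k] 1) n
  rw [scaledPopLaw, measureReal_nnreal_smul_apply, map_measureReal_apply hmeas measurableSet_Iic,
    measureReal_restrict_apply (hmeas measurableSet_Iic), survivingTreeLaw,
    measureReal_restrict_apply ((hmeas measurableSet_Iic).inter hB),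
    Real.coe_toNNReal _ (inv_nonneg.2 hb), inv_mul_eq_div]
  congr 2
  ext t
  simp only [Set.mem_inter_iff, mem_smallDev_iff hk, Set.mem_preimage, Set.mem_Iic,
    Set.mem_ofPred_eq]
  tauto

end ScaledPopLaw

section Limits

variable {ν : Measure ℕ} [IsProbabilityMeasure ν] {α x c : ℝ} {m p k : ℕ → ℕ}

theorem tendsto_integral_exp_scaledPopLaw_univ (h : IsCriticalStep α (survival ν)) (hα : 0 < α)
    (hm : Tendsto m atTop atTop) (hmn : Tendsto (fun n => (m n : ℝ) / n) atTop (𝓝 0))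
    (hc : 0 < c) :
    Tendsto (fun n => ∫ y, Real.exp (-(c * y)) ∂scaledPopLaw ν ((survival ν)^[m n] 1)
      (m n * incr (survival ν) n) n Set.univ) atTop (𝓝 (c ^ (-α))) := by
  refine (h.tendsto_orbit_sub_iterate_one_sub_exp hα hm hmn hc).congr fun n => ?_
  have := h.incr_pos n
  rw [integral_exp_scaledPopLaw_univ (by positivity) (h.orbit_pos _).le hc.le]

theorem tendsto_smallDev_div (h : IsCriticalStep α (survival ν)) (hα : 0 < α)
    (hm : Tendsto m atTop atTop) (hmn : Tendsto (fun n => (m n : ℝ) / n) atTop (𝓝 0)) :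
    Tendsto (fun n => (treeLaw ν).real (smallDev ν (fun u t => t u) (m n) n) /
      (m n * incr (survival ν) n)) atTop (𝓝 (1 / Real.Gamma (α + 1))) := by
  rw [← powerLaw_real_Iic_one hα]
  refine (tendsto_measureReal_Iic
    (μ := fun n => scaledPopLaw ν ((survival ν)^[m n] 1) (m n * incr (survival ν) n) n Set.univ)
    (fun n => isLaplaceMeasure_scaledPopLaw (h.orbit_pos (m n)).le) (isLaplaceMeasure_powerLaw hα)
    (fun i => ?_) zero_le_one (powerLaw_singleton α 1)).congr fun n => ?_
  · rw [integral_exp_powerLaw hα (by positivity)]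
    exact tendsto_integral_exp_scaledPopLaw_univ h hα hm hmn (by positivity)
  · have := h.incr_pos n
    rw [scaledPopLaw_real_Iic_one (by positivity) (h.orbit_pos _) .univ, Set.inter_univ]

theorem hasSum_negBinCoeff_sub_one {Φ t : ℝ} (hα : 0 < α) (hΦ : |t * Φ| < 1) (x : ℝ) :
    HasSum (fun j => (if j = 0 then 0 else x * (negBinCoeff α j * Φ ^ j)) * t ^ j)
      (x * ((1 - t * Φ) ^ (-α) - 1)) := by
  have hsum := (hasSum_ite_sub_hasSum (hasSum_negBinCoeff hα hΦ) 0).mul_left x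
  rw [negBinCoeff_zero hα, pow_zero, mul_one] at hsum
  refine hsum.congr_fun fun j => ?_
  split_ifs
  · simp
  · rw [mul_pow]
    ring

theorem tendsto_integral_exp_scaledPopLaw_reducedSize (h : IsCriticalStep α (survival ν))
    (hα : 0 < α) (hx : 0 < x) (hs : IndexScaling x m p k) (hc : 0 < c) {j : ℕ} (hj : j ≠ 0) :
    Tendsto (fun n => ∫ y, Real.exp (-(c * y)) ∂scaledPopLaw ν ((survival ν)^[m n] 1)
      (m n * incr (survival ν) n) n {t | reducedSize t (p n) n = j}) atTop
      (𝓝 (x * (negBinCoeff α j * slackLaplace α x c ^ j))) := by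
  have hΦ := slackLaplace_mem hα hx hc
  have hexp : ∀ n, Real.exp (-(c * (survival ν)^[m n] 1)) ∈ Set.Icc (0 : ℝ) 1 := fun n =>
    have := h.orbit_pos (m n)
    ⟨(Real.exp_pos _).le, Real.exp_le_one_iff.2 (neg_nonpos.2 (by positivity))⟩
  have hb : ∀ n, 0 ≤ m n * incr (survival ν) n := fun n =>
    mul_nonneg (Nat.cast_nonneg _) (h.incr_pos n).le
  have hlim := tendsto_setIntegral_eq_of_tendsto_integral_mul_pow (l := atTop)
    (μ := survivingTreeLaw ν) (R := fun n t => reducedSize t (p n) n)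
    (W := fun n t => Real.exp (-(c * (survival ν)^[m n] 1)) ^ popSize t n /
      (m n * incr (survival ν) n))
    (w := fun j => if j = 0 then 0 else x * (negBinCoeff α j * slackLaplace α x c ^ j))
    (F := fun t => x * ((1 - t * slackLaplace α x c) ^ (-α) - 1))
    (fun n => (integrable_pow_popSize (hexp n) n).restrict.div_const _)
    (fun n t => div_nonneg (pow_nonneg (hexp n).1 _) (hb n))
    (fun n => measurable_reducedSize (p n) n) (fun j => ?_)
    (fun t ht => hasSum_negBinCoeff_sub_one hα ?_ x) (fun t ht => ?_) j
  · simp only [if_neg hj] at hlim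
    refine hlim.congr fun n => ?_
    rw [integral_exp_scaledPopLaw (hb n), integral_div]
  · have := negBinCoeff_pos hα j
    have := hΦ.1
    positivity
  · rw [abs_of_nonneg (mul_nonneg ht.1 hΦ.1)]
    exact mul_lt_one_of_nonneg_of_lt_one_right ht.2 hΦ.1 hΦ.2
  · refine (h.tendsto_iterate_orbit_sub_iterate hα hx hs hc ht).congr' ?_
    filter_upwards [hs.add_eq] with n hn
    rw [← integral_pow_mul_pow_survivingTreeLaw (hexp n) (Set.Ico_subset_Icc_self ht) hn,
      ← integral_div]
    simp only [div_mul_eq_mul_div]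

end Limits

section DilatedConvPow

variable {M : Measure ℝ} {r b c : ℝ} {j : ℕ}

/-- The image of the `j`-fold convolution power of `M` under dilation by `r`, with total mass
multiplied by `b`. -/
noncomputable def dilatedConvPow (M : Measure ℝ) (r b : ℝ) (j : ℕ) : Measure ℝ :=
  b.toNNReal • (convPow M j).map (r * ·)

instance [IsFiniteMeasure M] : IsFiniteMeasure (dilatedConvPow M r b j) := by
  rw [dilatedConvPow]
  infer_instance

theorem isLaplaceMeasure_dilatedConvPow [IsFiniteMeasure M] (h : ∀ᵐ y ∂M, 0 ≤ y) (hr : 0 ≤ r) :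
    IsLaplaceMeasure (dilatedConvPow M r b j) :=
  .of_ae_nonneg <| Measure.ae_smul_measure
    ((ae_map_iff (by fun_prop) measurableSet_Ici).2 <|
      (ae_nonneg_convPow h j).mono fun _ hy => mul_nonneg hr hy) _

theorem integral_exp_dilatedConvPow [IsFiniteMeasure M] (hb : 0 ≤ b) :
    ∫ y, Real.exp (-(c * y)) ∂dilatedConvPow M r b j =
      b * (∫ y, Real.exp (-(c * r * y)) ∂M) ^ j := by
  rw [dilatedConvPow, integral_smul_nnreal_measure, integral_map (by fun_prop) (by fun_prop),
    NNReal.smul_def, Real.coe_toNNReal _ hb, smul_eq_mul, ← integral_exp_convPow]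
  simp only [mul_assoc]

theorem dilatedConvPow_real_Iic_one (hb : 0 ≤ b) (hr : 0 < r) :
    (dilatedConvPow M r b j).real (Set.Iic 1) = b * (convPow M j).real (Set.Iic r⁻¹) := by
  rw [dilatedConvPow, measureReal_nnreal_smul_apply, Real.coe_toNNReal _ hb,
    map_measureReal_apply (by fun_prop) measurableSet_Iic, Set.preimage_const_mul_Iic₀ _ hr,
    one_div]

end DilatedConvPow

section Limits

variable {ν : Measure ℕ} [IsProbabilityMeasure ν] {α x c : ℝ} {m p k : ℕ → ℕ} {M : Measure ℝ}
  {j : ℕ}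

theorem tendsto_smallDev_inter_div (h : IsCriticalStep α (survival ν)) (hα : 0 < α)
    (hM : IsSlackLaw α M) (hx : 0 < x) (hs : IndexScaling x m p k) (hj : j ≠ 0) :
    Tendsto (fun n => (treeLaw ν).real
      (smallDev ν (fun u t => t u) (m n) n ∩ {t | reducedSize t (p n) n = j}) /
        (m n * incr (survival ν) n)) atTop
      (𝓝 (x * negBinCoeff α j * (convPow M j).real (Set.Iic (x ^ (-(1 / α)))))) := by
  have := hM.prob
  have hw : 0 ≤ x * negBinCoeff α j := mul_nonneg hx.le (negBinCoeff_pos hα j).le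
  have hr : 0 < x ^ (1 / α) := Real.rpow_pos_of_pos hx _
  rw [Real.rpow_neg hx.le, ← dilatedConvPow_real_Iic_one hw hr]
  refine (tendsto_measureReal_Iic_of_le
    (μ := fun n => scaledPopLaw ν ((survival ν)^[m n] 1) (m n * incr (survival ν) n) n
      {t | reducedSize t (p n) n = j})
    (σ := fun n => scaledPopLaw ν ((survival ν)^[m n] 1) (m n * incr (survival ν) n) n Set.univ)
    (fun n => isLaplaceMeasure_scaledPopLaw (h.orbit_pos (m n)).le)
    (isLaplaceMeasure_dilatedConvPow (isSlackLaw_iff.1 hM).2.1 hr.le)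
    (fun n => isLaplaceMeasure_scaledPopLaw (h.orbit_pos (m n)).le)
    (isLaplaceMeasure_powerLaw hα) (fun _ => scaledPopLaw_le_univ) (fun i => ?_) (fun i => ?_)
    zero_le_one (powerLaw_singleton α 1)).congr fun n => ?_
  · rw [integral_exp_dilatedConvPow hw, hM.integral_exp_mul_rpow hα hx (by positivity), mul_assoc]
    exact tendsto_integral_exp_scaledPopLaw_reducedSize h hα hx hs (by positivity) hj
  · rw [integral_exp_powerLaw hα (by positivity)]
    exact tendsto_integral_exp_scaledPopLaw_univ h hα hs.tendsto_m hs.m_div (by positivity)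
  · exact scaledPopLaw_real_Iic_one (mul_nonneg (Nat.cast_nonneg _) (h.incr_pos n).le)
      (h.orbit_pos _) (measurable_reducedSize (p n) n (measurableSet_singleton j))

theorem tendsto_cond_smallDev (h : IsCriticalStep α (survival ν)) (hα : 0 < α)
    (hM : IsSlackLaw α M) (hx : 0 < x) (hs : IndexScaling x m p k) (hj : j ≠ 0) :
    Tendsto (fun n => ((treeLaw ν)[|smallDev ν (fun u t => t u) (m n) n]).real
      {t | reducedSize t (p n) n = j}) atTop
      (𝓝 (α * Real.Gamma (j + α) / j.factorial * x *
        (convPow M j).real (Set.Iic (x ^ (-(1 / α)))))) := by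
  have hratio := (tendsto_smallDev_inter_div h hα hM hx hs hj).div
    (tendsto_smallDev_div h hα hs.tendsto_m hs.m_div)
    (one_div_ne_zero (Real.Gamma_pos_of_pos (add_pos hα one_pos)).ne')
  have hΓ := (Real.Gamma_pos_of_pos hα).ne'
  have hvalue : x * negBinCoeff α j * (convPow M j).real (Set.Iic (x ^ (-(1 / α)))) /
      (1 / Real.Gamma (α + 1)) = α * Real.Gamma (j + α) / j.factorial * x *
        (convPow M j).real (Set.Iic (x ^ (-(1 / α)))) := by
    rw [negBinCoeff, Real.Gamma_add_one hα.ne']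
    field_simp
  rw [hvalue] at hratio
  refine hratio.congr' ?_
  filter_upwards [hs.tendsto_m.eventually (eventually_gt_atTop 0)] with n hmn
  have hb : (m n : ℝ) * incr (survival ν) n ≠ 0 :=
    mul_ne_zero (Nat.cast_ne_zero.2 hmn.ne') (h.incr_pos n).ne'
  rw [Pi.div_apply, div_div_div_cancel_right₀ hb, Measure.real, Measure.real, Measure.real,
    cond_apply (measurableSet_smallDev (m n)), ENNReal.toReal_mul, ENNReal.toReal_inv,
    div_eq_inv_mul]

end Limits

section Existence

variable {ν : Measure ℕ} [IsProbabilityMeasure ν] {α : ℝ}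

theorem isProbabilityMeasure_scaledPopLaw {a : ℝ} {n : ℕ} (ha : 0 ≤ a)
    (hn : 0 < (survival ν)^[n] 1) :
    IsProbabilityMeasure (scaledPopLaw ν a ((survival ν)^[n] 1) n Set.univ) := by
  have hmass := integral_exp_scaledPopLaw_univ (ν := ν) (n := n) hn.le ha le_rfl
  simp only [zero_mul, neg_zero, Real.exp_zero, sub_self, integral_const, smul_eq_mul, mul_one,
    Function.iterate_fixed (survival_zero (ν := ν)) n, sub_zero, div_self hn.ne'] at hmass
  exact isProbabilityMeasure_iff_real.2 hmass

theorem exists_isSlackLaw (h : IsCriticalStep α (survival ν)) (hα : 0 < α) :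
    ∃ M, IsSlackLaw α M := by
  have hprob : ∀ n, IsProbabilityMeasure
      (scaledPopLaw ν ((survival ν)^[n] 1) ((survival ν)^[n] 1) n Set.univ) := fun n =>
    isProbabilityMeasure_scaledPopLaw (h.orbit_pos n).le (h.orbit_pos n)
  have hdiv : Tendsto (fun n : ℕ => (n : ℝ) / n) atTop (𝓝 1) :=
    tendsto_const_nhds.congr' <| (eventually_ne_atTop 0).mono fun n hn =>
      (div_self (Nat.cast_ne_zero.2 hn)).symm
  simp only [isSlackLaw_iff]
  refine exists_isProbabilityMeasure_of_tendsto_laplace (l := atTop)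
    (μ := fun n => scaledPopLaw ν ((survival ν)^[n] 1) ((survival ν)^[n] 1) n Set.univ)
    (fun n => (isLaplaceMeasure_scaledPopLaw (h.orbit_pos n).le).ae_nonneg) (fun c hc => ?_)
    (tendsto_slackLaplace_zero hα one_pos)
  refine ((h.tendsto_iterate_one_sub_exp_div_orbit hα one_pos tendsto_id hdiv hc).const_sub
    1).congr fun n => ?_
  rw [integral_exp_scaledPopLaw_univ (h.orbit_pos n).le (h.orbit_pos n).le hc.le, sub_div,
    div_self (h.orbit_pos n).ne', id_eq]

end Existence

section FloorScaling

variable {φ : ℕ → ℝ} {x : ℝ}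

theorem eventually_mul_le_natCast_of_tendsto_div
    (hφn : Tendsto (fun n : ℕ => φ n / (n : ℝ)) atTop (𝓝 0)) (hx : 0 < x) :
    ∀ᶠ n : ℕ in atTop, x * φ n ≤ n := by
  filter_upwards [hφn.eventually (gt_mem_nhds (inv_pos.2 hx)), eventually_gt_atTop 0]
    with n hn hn0
  rw [div_lt_iff₀ (Nat.cast_pos.2 hn0), inv_mul_eq_div, lt_div_iff₀' hx] at hn
  exact hn.le

theorem floor_sub_le {n : ℕ} {y : ℝ} (hy : 0 ≤ y) : ⌊(n : ℝ) - y⌋₊ ≤ n :=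
  Nat.floor_le_of_le (sub_le_self _ hy)

theorem tendsto_sub_floor_div (hφ : Tendsto φ atTop atTop)
    (hφn : Tendsto (fun n : ℕ => φ n / (n : ℝ)) atTop (𝓝 0)) (hx : 0 < x) :
    Tendsto (fun n : ℕ => ((n - ⌊(n : ℝ) - x * φ n⌋₊ : ℕ) : ℝ) / φ n) atTop (𝓝 x) := by
  have hinv : Tendsto (fun n => x + (φ n)⁻¹) atTop (𝓝 (x + 0)) :=
    (tendsto_inv_atTop_zero.comp hφ).const_add x
  rw [add_zero] at hinv
  refine tendsto_of_tendsto_of_tendsto_of_le_of_le' tendsto_const_nhds hinv ?_ ?_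
  · filter_upwards [hφ.eventually (eventually_gt_atTop 0),
      eventually_mul_le_natCast_of_tendsto_div hφn hx] with n hpos hle
    rw [le_div_iff₀ hpos, Nat.cast_sub (floor_sub_le (by positivity))]
    linarith [Nat.floor_le (sub_nonneg.2 hle)]
  · filter_upwards [hφ.eventually (eventually_gt_atTop 0)] with n hpos
    rw [div_le_iff₀ hpos, Nat.cast_sub (floor_sub_le (by positivity)), add_mul,
      inv_mul_cancel₀ hpos.ne']
    linarith [Nat.lt_floor_add_one ((n : ℝ) - x * φ n)]

theorem indexScaling_floor (hφ : Tendsto φ atTop atTop)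
    (hφn : Tendsto (fun n : ℕ => φ n / (n : ℝ)) atTop (𝓝 0)) (hx : 0 < x) :
    IndexScaling x (fun n => ⌊φ n⌋₊) (fun n => ⌊(n : ℝ) - x * φ n⌋₊)
      (fun n => n - ⌊(n : ℝ) - x * φ n⌋₊) := by
  have hpos : ∀ᶠ n in atTop, 0 < φ n := hφ.eventually (eventually_gt_atTop 0)
  have hfloor : Tendsto (fun n => (⌊φ n⌋₊ : ℝ) / φ n) atTop (𝓝 1) :=
    (tendsto_nat_floor_div_atTop (R := ℝ)).comp hφ
  refine ⟨tendsto_nat_floor_atTop.comp hφ, ?_, ?_, ?_⟩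
  · have hm := hfloor.mul hφn
    rw [mul_zero] at hm
    refine hm.congr' (hpos.mono fun n hn => ?_)
    exact div_mul_div_cancel₀ hn.ne'
  · have hk := (tendsto_sub_floor_div hφ hφn hx).div hfloor one_ne_zero
    rw [div_one] at hk
    exact hk.congr' (hpos.mono fun n hn => div_div_div_cancel_right₀ hn.ne' _ _)
  · exact hpos.mono fun n hn => Nat.add_sub_of_le (floor_sub_le (by positivity))

end FloorScaling

section OffspringFamily

variable {Ω : Type*} [MeasurableSpace Ω] {P : Measure Ω} {ν : Measure ℕ} {ξ : List ℕ → Ω → ℕ}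

theorem IsOffspringFamily.isProbabilityMeasure [IsProbabilityMeasure P]
    (hξ : IsOffspringFamily P ν ξ) : IsProbabilityMeasure ν :=
  hξ.law [] ▸ Measure.isProbabilityMeasure_map (hξ.measurable []).aemeasurable

theorem IsOffspringFamily.map_eq_treeLaw (hξ : IsOffspringFamily P ν ξ) :
    P.map (fun ω u => ξ u ω) = treeLaw ν := by
  rw [hξ.indep.map_fun_eq_infinitePi_map hξ.measurable]
  simp only [hξ.law, treeLaw]

theorem IsOffspringFamily.cond_smallDev_real (hξ : IsOffspringFamily P ν ξ) (k n : ℕ)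
    {B : Set (List ℕ → ℕ)} (hB : MeasurableSet B) :
    (P[|smallDev ν ξ k n]).real {ω | (fun u => ξ u ω) ∈ B} =
      ((treeLaw ν)[|smallDev ν (fun u t => t u) k n]).real B := by
  have hT : Measurable fun ω u => ξ u ω := measurable_pi_lambda _ hξ.measurable
  have hE := measurableSet_smallDev (ν := ν) (n := n) k
  have hpre : smallDev ν ξ k n = (fun ω u => ξ u ω) ⁻¹' smallDev ν (fun u t => t u) k n := rfl
  rw [Measure.real, Measure.real, hpre, cond_apply (hT hE), cond_apply hE, ← hξ.map_eq_treeLaw,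
    Measure.map_apply hT hE, Measure.map_apply hT (hE.inter hB)]
  rfl

end OffspringFamily

end GaltonWatson

theorem theorem2_general {Ω : Type*} [MeasurableSpace Ω] (P : Measure Ω) [IsProbabilityMeasure P]
    (ν : Measure ℕ) (ξ : List ℕ → Ω → ℕ) (hξ : GaltonWatson.IsOffspringFamily P ν ξ)
    (α : ℝ) (hα : 0 < α) (L : ℝ → ℝ) (hν : GaltonWatson.CriticalOffspring α L ν)
    (φ : ℕ → ℝ) (hφ : Tendsto φ atTop atTop)
    (hφn : Tendsto (fun n : ℕ => φ n / (n : ℝ)) atTop (𝓝 0)) :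
    (∃! M : Measure ℝ, GaltonWatson.IsSlackLaw α M) ∧
    ∀ M : Measure ℝ, GaltonWatson.IsSlackLaw α M →
      ∀ x : ℝ, 0 < x → ∀ j : ℕ, 1 ≤ j →
        Tendsto
          (fun n : ℕ =>
            (P[|GaltonWatson.smallDev ν ξ ⌊φ n⌋₊ n]).real
              {ω | GaltonWatson.reducedSize (fun u => ξ u ω) ⌊(n : ℝ) - x * φ n⌋₊ n = j})
          atTop
          (𝓝 (α * Real.Gamma ((j : ℝ) + α) / (j.factorial : ℝ) * x *
            (GaltonWatson.convPow M j).real (Set.Iic (x ^ (-(1 / α)))))) := by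
  have := hξ.isProbabilityMeasure
  have hstep := hν.isCriticalStep_survival hα
  obtain ⟨M, hM⟩ := GaltonWatson.exists_isSlackLaw hstep hα
  refine ⟨⟨M, hM, fun M' hM' => hM'.unique hM⟩, fun M hM x hx j hj => ?_⟩
  refine (GaltonWatson.tendsto_cond_smallDev hstep hα hM hx
    (GaltonWatson.indexScaling_floor hφ hφn hx) (Nat.one_le_iff_ne_zero.1 hj)).congr fun n => ?_
  exact (hξ.cond_smallDev_real _ _
    (GaltonWatson.measurable_reducedSize _ n (measurableSet_singleton j))).symm

theorem theorem2 {Ω : Type*} [MeasurableSpace Ω] (P : Measure Ω) [IsProbabilityMeasure P]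
    (ν : Measure ℕ) (ξ : List ℕ → Ω → ℕ) (hξ : GaltonWatson.IsOffspringFamily P ν ξ)
    (α : ℝ) (hα₀ : 0 < α) (hα₁ : α < 1) (L : ℝ → ℝ) (hν : GaltonWatson.CriticalOffspring α L ν)
    (φ : ℕ → ℝ) (hφ : Tendsto φ atTop atTop)
    (hφn : Tendsto (fun n : ℕ => φ n / (n : ℝ)) atTop (𝓝 0)) :
    (∃! M : Measure ℝ, GaltonWatson.IsSlackLaw α M) ∧
    ∀ M : Measure ℝ, GaltonWatson.IsSlackLaw α M →
      ∀ x : ℝ, 0 < x → ∀ j : ℕ, 1 ≤ j →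
        Tendsto
          (fun n : ℕ =>
            (P[|GaltonWatson.smallDev ν ξ ⌊φ n⌋₊ n]).real
              {ω | GaltonWatson.reducedSize (fun u => ξ u ω) ⌊(n : ℝ) - x * φ n⌋₊ n = j})
          atTop
          (𝓝 (α * Real.Gamma ((j : ℝ) + α) / (j.factorial : ℝ) * x *
            (GaltonWatson.convPow M j).real (Set.Iic (x ^ (-(1 / α)))))) :=
  theorem2_general P ν ξ hξ α hα₀ L hν φ hφ hφn
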